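/- Setting. Let $\mathcal A$ be a finite set of $K\ge 1$ actions, $\mathcal X$ a measurable space of contexts, and $\mathcal F$ a finite class, $|\mathcal F|\ge 4$, of measurable predictors $f:\mathcal X\times\mathcal A\to[0,1]$. In each round $t=1,\dots,T$ nature draws, independently of the past, a context $x_t\in\mathcal X$ and a reward vector $r_t\in[0,1]^{\mathcal A}$ from a fixed law $\mathcal D$; the learner sees $x_t$, picks $a_t\in\mathcal A$ and observes $r_t(a_t)$. Assume realizability: for some $f^*\in\mathcal F$, $\mathbb E[r_t(a)\mid x_t=x]=f^*(x,a)$ for all $x$ and $a$. Let $\pi_{f^*}(x)\in\arg\max_a f^*(x,a)$; the regret after $T$ rounds is $\sum_{t=1}^T\bigl(r_t(\pi_{f^*}(x_t))-r_t(a_t)\bigr)$. Algorithm. Given an epoch schedule $0=\tau_0\le\tau_1\le\tau_2\le\cdots$ and $\delta\in(0,1)$, round $t$ belongs to epoch $m(t)=\min\{m\ge 1: t\le\tau_m\}$. FALCON sets, for epoch $m$, $\gamma_1=1$ and $\gamma_m=\frac1{30}\sqrt{K\tau_{m-1}/\log(|\mathcal F|\tau_{m-1}/\delta)}$ for $m\ge2$,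 and makes one call to an offline least-squares oracle to get $\widehat f_m\in\arg\min_{f\in\mathcal F}\sum_{t=1}^{\tau_{m-1}}(f(x_t,a_t)-r_t(a_t))^2$. In each round $t$ of epoch $m$ it takes $\widehat a_t\in\arg\max_a\widehat f_m(x_t,a)$ and, given the past and $x_t$, draws $a_t$ with probabilities $p_t(a)=1/\bigl(K+\gamma_m(\widehat f_m(x_t,\widehat a_t)-\widehat f_m(x_t,a))\bigr)$ for $a\ne\widehat a_t$ and $p_t(\widehat a_t)=1-\sum_{a\ne\widehat a_t}p_t(a)$. The oracle is deterministic; ties in all minima and maxima are broken arbitrarily (measurably). Schedules. For known $T\ge3$ consider (a) $\tau_m=\lceil T^{1-2^{-m}}\rceil$ for all $m\ge1$; and (b) the same schedule with epoch $M=\lceil\log_2\log_2T\rceil$ made the last one, i.e. $\tau_m=\lceil T^{1-2^{-m}}\rceil$ for $1\le m<M$ and $\tau_m=T$ for $m\ge M$. Claim. There is an absolute constant $C>0$ such that for every integer $T\ge3$: (1) under schedule (b), FALCON runs in $m(T)\le C\log\log T$ epochs over the $T$ rounds, and hence makes only $O(\log\log T)$ oracle calls; (2) under schedule (a) and also under schedule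 (b), for every instance as above and every $\delta\in(0,1)$, with probability at least $1-\delta$ the regret of FALCON after $T$ rounds is at most $$C\,\sqrt{KT\log(|\mathcal F|T/\delta)}\;\log\log T .$$ -/

import Mathlib

open MeasureTheory ProbabilityTheory Finset
open scoped unitInterval

noncomputable section

namespace Falcon

/-! ### Epoch schedules.
`τ m` is the last round of epoch `m`, `τ 0 = 0`; epoch `m ≥ 1` consists of the rounds
`τ (m - 1) + 1, …, τ m`. -/

/-- The schedule `τ_m = ⌈T ^ (1 - 2 ^ (-m))⌉` for `m ≥ 1`, with `τ_0 = 0`. -/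
def schedule (T m : ℕ) : ℕ :=
  if m = 0 then 0 else ⌈(T : ℝ) ^ (1 - (1 / 2 : ℝ) ^ m)⌉₊

/-- The number `⌈log₂ log₂ T⌉`. -/
def lastEpoch (T : ℕ) : ℕ := ⌈Real.logb 2 (Real.logb 2 (T : ℝ))⌉₊

/-- The same schedule, except that epoch number `⌈log₂ log₂ T⌉` is the last one: it is extended up
to the horizon `T`. -/
def closedSchedule (T m : ℕ) : ℕ :=
  if m < lastEpoch T then schedule T m else T

/-- `m(t) = min {m ≥ 1 : t ≤ τ_m}`, the epoch that contains round `t ≥ 1`. Every epoch makes exactly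
one oracle call (when it starts), so `epochOf τ T` is also the number of epochs, and of oracle
calls, over `T` rounds. -/
def epochOf (τ : ℕ → ℕ) (t : ℕ) : ℕ := sInf {m : ℕ | 1 ≤ m ∧ t ≤ τ m}

/-! ### Predictors, oracle, greedy actions.
`X` is the space of contexts and `A` the finite set of actions; a predictor is a function
`X → A → [0, 1]`. -/

variable {X A : Type*}

/-- The squared loss of `f` on the sequence `d` of triples (context, action, reward). -/
def squaredLoss {n : ℕ} (f : X → A → I) (d : Fin n → X × A × I) : ℝ :=
  ∑ i, ((f (d i).1 (d i).2.1 : ℝ) - ((d i).2.2 : ℝ)) ^ 2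

/-- `oracle` is a deterministic offline least-squares regression oracle for the class `F`, with an
arbitrary (measurable) way of breaking ties. -/
structure IsLeastSquaresOracle [MeasurableSpace X] [MeasurableSpace A] (F : Finset (X → A → I))
    (oracle : (n : ℕ) → (Fin n → X × A × I) → (X → A → I)) : Prop where
  mem : ∀ n d, oracle n d ∈ F
  le : ∀ n d, ∀ f ∈ F, squaredLoss (oracle n d) d ≤ squaredLoss f d
  measurableSet : ∀ n, ∀ f ∈ F, MeasurableSet {d | oracle n d = f}

/-- `π` is a (measurable) policy that always picks an action with the highest reward predicted by
`f`; ties are broken arbitrarily. -/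
structure IsGreedyPolicy [MeasurableSpace X] [MeasurableSpace A] (f : X → A → I)
    (π : X → A) : Prop where
  le : ∀ x a, f x a ≤ f x (π x)
  measurable : Measurable π

/-- Realizability of the law `D` of a pair (context, reward vector) by `f`:
`E[r(a) | x] = f(x, a)` for every action `a`. -/
def Realizes [MeasurableSpace X] (D : Measure (X × (A → I))) (f : X → A → I) : Prop :=
  ∀ a, D[fun z => ((z.2 a : I) : ℝ) | MeasurableSpace.comap Prod.fst inferInstance]
    =ᵐ[D] fun z => (f z.1 a : ℝ)

/-! ### The algorithm. -/

/-- The learning rate `γ_m`, where `K` is the number of actions and `N` the number of predictors: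
`γ_1 = 1`, and `γ_m = (1/30) √(K τ_{m-1} / log (N τ_{m-1} / δ))` for `m ≥ 2`. -/
def learningRate (K N : ℕ) (δ : ℝ) (τ : ℕ → ℕ) (m : ℕ) : ℝ :=
  if m = 1 then 1
  else (1 / 30) * √((K : ℝ) * (τ (m - 1) : ℝ) / Real.log ((N : ℝ) * (τ (m - 1) : ℝ) / δ))

/-- The probability of action `a` when the context is `x`, the predictor is `f`, the learning rate
is `γ` and the greedy action is `b`. -/
def actionProb [Fintype A] [DecidableEq A] (γ : ℝ) (f : X → A → I) (x : X) (b a : A) : ℝ :=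
  if a = b then
    1 - ∑ c ∈ univ.erase b, 1 / ((Fintype.card A : ℝ) + γ * ((f x b : ℝ) - (f x c : ℝ)))
  else 1 / ((Fintype.card A : ℝ) + γ * ((f x b : ℝ) - (f x a : ℝ)))

variable {Ω : Type*}

/-- Everything that happened in the rounds `1, …, n`: contexts, full reward vectors, actions. -/
def history (x : ℕ → Ω → X) (r : ℕ → Ω → A → I) (a : ℕ → Ω → A) (n : ℕ) (ω : Ω) :
    Fin n → X × (A → I) × A :=
  fun i => (x (i + 1) ω, r (i + 1) ω, a (i + 1) ω)

/-- What the learner observed in the rounds `1, …, n`: contexts, actions, rewards of the actions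
taken. -/
def observed (x : ℕ → Ω → X) (r : ℕ → Ω → A → I) (a : ℕ → Ω → A) (n : ℕ) (ω : Ω) :
    Fin n → X × A × I :=
  fun i => (x (i + 1) ω, a (i + 1) ω, r (i + 1) ω (a (i + 1) ω))

/-- The predictor `f̂_m` of epoch `m`: the answer of the oracle on the data of all earlier epochs. -/
def predictor (oracle : (n : ℕ) → (Fin n → X × A × I) → (X → A → I)) (τ : ℕ → ℕ)
    (x : ℕ → Ω → X) (r : ℕ → Ω → A → I) (a : ℕ → Ω → A) (m : ℕ) (ω : Ω) : X → A → I :=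
  oracle (τ (m - 1)) (observed x r a (τ (m - 1)) ω)

/-- The processes `x`, `r`, `a` (contexts, reward vectors, actions, in the rounds `1, …, T`) on the
probability space `(Ω, μ)` are a run of FALCON over `T` rounds, with nature's law `D`, predictors
`F`, a least-squares oracle `oracle`, greedy actions `greedy f x`, schedule `τ` and confidence
parameter `δ`. -/
structure IsRun [MeasurableSpace X] [MeasurableSpace A] [Fintype A] [DecidableEq A]
    [MeasurableSpace Ω] (μ : Measure Ω) (D : Measure (X × (A → I))) (F : Finset (X → A → I))
    (oracle : (n : ℕ) → (Fin n → X × A × I) → (X → A → I))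
    (greedy : (X → A → I) → X → A) (τ : ℕ → ℕ) (δ : ℝ) (T : ℕ)
    (x : ℕ → Ω → X) (r : ℕ → Ω → A → I) (a : ℕ → Ω → A) : Prop where
  measurable_context : ∀ t, Measurable (x t)
  measurable_reward : ∀ t, Measurable (r t)
  measurable_action : ∀ t, Measurable (a t)
  /-- In round `n + 1` nature draws the context and the reward vector from `D` … -/
  law : ∀ n < T, μ.map (fun ω => (x (n + 1) ω, r (n + 1) ω)) = D
  /-- … independently of the past. -/
  indep : ∀ n < T, IndepFun (fun ω => (x (n + 1) ω, r (n + 1) ω)) (history x r a n) μ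
  /-- Given the past, the context and the reward vector, the action of round `n + 1`, which belongs
  to epoch `m = epochOf τ (n + 1)`, is drawn from the distribution that the learner computes from
  `γ_m`, `f̂_m` and the context. -/
  action : ∀ n < T, ∀ b : A,
    μ[({ω | a (n + 1) ω = b}).indicator (fun _ => (1 : ℝ)) |
        MeasurableSpace.comap (fun ω => (history x r a n ω, x (n + 1) ω, r (n + 1) ω))
          inferInstance]
      =ᵐ[μ] fun ω =>
        actionProb (learningRate (Fintype.card A) #F δ τ (epochOf τ (n + 1)))
          (predictor oracle τ x r a (epochOf τ (n + 1)) ω) (x (n + 1) ω)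
          (greedy (predictor oracle τ x r a (epochOf τ (n + 1)) ω) (x (n + 1) ω)) b

/-- The regret `∑_{t ≤ T} (r_t(π(x_t)) - r_t(a_t))` against the policy `π`. -/
def regret (π : X → A) (x : ℕ → Ω → X) (r : ℕ → Ω → A → I) (a : ℕ → Ω → A) (T : ℕ)
    (ω : Ω) : ℝ :=
  ∑ t ∈ Icc 1 T, ((r t ω (π (x t ω)) : ℝ) - (r t ω (a t ω) : ℝ))

end Falcon

end

noncomputable section

namespace Falcon

open scoped ENNReal

/-! The argument compares two regrets of an arbitrary randomized policy `q`: the true mean regret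
R(q), computed with `fstar`, and the predicted regret R_m(q), computed with the predictor of epoch
m. Up to a factor 2 and an error K/γ_m they agree, for all `q` simultaneously, once m ≥ 2. Inverse
gap weighting gives the policy of epoch m predicted regret at most K/γ_m, so its true regret per
round is at most 3K/γ_m, which is of order √(K log(NT/δ) / τ_{m-1}) with N = #F.

Accuracy of the predictors comes from an exponential supermartingale. By realizability the excess
squared loss of f over `fstar` in a round has conditional mean equal to the mean squared difference
of f and `fstar` under the policy of that round, and its second moment is bounded by a multiple of
the same quantity. Markov's inequality and a union bound over f and over the number n of rounds show
that a least-squares fit on n rounds has total squared error at most 32 log(Nn/δ) under the policies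
that produced the data (`IsAdaptiveRun.measure_exists_sqErr_gt_le`).

The comparison of regrets (`meanRegret_comparison`) is an induction on epochs. An error under past
policies becomes an error under `q` by a change of measure (`absErr_le`): the inverse probability of
an action under a past policy is at most K + γ·gap, whose mean under `q` is K + γ times a past
predicted regret, and the induction hypothesis bounds this by R(q). The resulting multiple of R(q)
is small enough to be absorbed.

For the sum over rounds (`IsGoodSchedule.sum_le`), the schedule satisfies τ_m - τ_{m-1} ≤ 2√(T
τ_{m-1}) for 2 ≤ m ≤ M = `lastEpoch T`, so each of the first M epochs costs O(√(KT log(NT/δ))). Past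
epoch M, τ_{m-1} ≥ T/2 and all remaining rounds together cost as much as one epoch, however many
epochs they form; this is why the unclosed schedule obeys the same bound. A second supermartingale
(`IsAdaptiveRun.measure_regret_gt_le`) passes from conditional means to the realized regret. -/

/-- A randomized policy: `q x b` is the probability of action `b` in context `x`. -/
structure IsStochasticPolicy {X A : Type*} [MeasurableSpace X] [Fintype A] (q : X → A → ℝ) :
    Prop where
  nonneg : ∀ x b, 0 ≤ q x b
  sum_eq_one : ∀ x, ∑ b, q x b = 1
  measurable : ∀ b, Measurable fun x => q x b

/-- A contextual bandit protocol over `T` rounds, in which the learner draws the action of round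
`n + 1` from the policy `P n h`, where `h` is the history of the first `n` rounds. -/
structure IsAdaptiveRun {X A Ω : Type*} [MeasurableSpace X] [Fintype A]
    [MeasurableSpace A] [MeasurableSpace Ω] (μ : Measure Ω) (D : Measure (X × (A → I)))
    (P : (n : ℕ) → (Fin n → X × (A → I) × A) → X → A → ℝ) (T : ℕ)
    (x : ℕ → Ω → X) (r : ℕ → Ω → A → I) (a : ℕ → Ω → A) : Prop where
  measurable_context : ∀ t, Measurable (x t)
  measurable_reward : ∀ t, Measurable (r t)
  measurable_action : ∀ t, Measurable (a t)
  law : ∀ n < T, μ.map (fun ω => (x (n + 1) ω, r (n + 1) ω)) = D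
  indep : ∀ n < T, IndepFun (fun ω => (x (n + 1) ω, r (n + 1) ω)) (history x r a n) μ
  policy : ∀ n h, IsStochasticPolicy (P n h)
  measurable_policy : ∀ n b, Measurable fun y : (Fin n → X × (A → I) × A) × X => P n y.1 y.2 b
  action : ∀ n < T, ∀ b : A,
    μ[({ω | a (n + 1) ω = b}).indicator (fun _ => (1 : ℝ)) |
        MeasurableSpace.comap (fun ω => (history x r a n ω, x (n + 1) ω, r (n + 1) ω))
          inferInstance]
      =ᵐ[μ] fun ω => P n (history x r a n ω) (x (n + 1) ω) b

/-! ### Conditional action probabilities and sums along a history -/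

/-- If `p ∘ W` is the conditional probability of `B` given `W`, then integrating a function of `W`
over `B` amounts to integrating it against the density `p ∘ W`. -/
theorem setLIntegral_comp_eq_of_condExp_indicator {Ω S : Type*} [MeasurableSpace Ω]
    [MeasurableSpace S] {μ : Measure Ω} [IsProbabilityMeasure μ] {W : Ω → S} (hW : Measurable W)
    {B : Set Ω} (hB : MeasurableSet B) {p : S → ℝ} (hp : Measurable p) (hp0 : ∀ s, 0 ≤ p s)
    (h : μ[B.indicator (fun _ => (1 : ℝ)) | MeasurableSpace.comap W inferInstance]
      =ᵐ[μ] fun ω => p (W ω))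
    {k : S → ℝ≥0∞} (hk : Measurable k) :
    ∫⁻ ω in B, k (W ω) ∂μ = ∫⁻ ω, ENNReal.ofReal (p (W ω)) * k (W ω) ∂μ := by
  have hpW : Measurable fun ω => ENNReal.ofReal (p (W ω)) := (hp.comp hW).ennreal_ofReal
  have hint : Integrable (fun ω => p (W ω)) μ := integrable_condExp.congr h
  have hle : MeasurableSpace.comap W inferInstance ≤ (inferInstance : MeasurableSpace Ω) :=
    hW.comap_le
  -- It suffices that both measures have the same image under `W`: the defining property of the
  -- conditional expectation, tested on the sets `W ⁻¹' s`.
  have key : (μ.restrict B).map W = (μ.withDensity fun ω => ENNReal.ofReal (p (W ω))).map W := by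
    ext s hs
    have hWs : MeasurableSet (W ⁻¹' s) := hW hs
    have hi : Integrable (B.indicator (fun _ => (1 : ℝ))) μ :=
      (integrable_const (1 : ℝ)).indicator hB
    have h1 : ∫ ω in W ⁻¹' s, p (W ω) ∂μ
        = ∫ ω in W ⁻¹' s, B.indicator (fun _ => (1 : ℝ)) ω ∂μ := by
      rw [← setIntegral_condExp hle hi ⟨s, hs, rfl⟩]
      exact setIntegral_congr_ae hWs (h.mono fun ω hω _ => hω.symm)
    rw [Measure.map_apply hW hs, Measure.map_apply hW hs, withDensity_apply _ hWs,
      Measure.restrict_apply hWs,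
      ← ofReal_integral_eq_lintegral_ofReal hint.integrableOn (ae_of_all _ fun ω => hp0 _), h1,
      integral_indicator hB, Measure.restrict_restrict hB]
    simp [Set.inter_comm, Measure.real]
  calc ∫⁻ ω in B, k (W ω) ∂μ = ∫⁻ s, k s ∂((μ.restrict B).map W) := (lintegral_map hk hW).symm
    _ = ∫⁻ s, k s ∂((μ.withDensity fun ω => ENNReal.ofReal (p (W ω))).map W) := by rw [key]
    _ = _ := by
      rw [lintegral_map hk hW]
      exact lintegral_withDensity_eq_lintegral_mul _ hpW (hk.comp hW)

/-- The sum `∑ i < n, G i (h 0, …, h (i - 1)) (h i)` along a history. -/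
def pathSum {E : Type*} (G : (n : ℕ) → (Fin n → E) → E → ℝ) : (n : ℕ) → (Fin n → E) → ℝ
  | 0, _ => 0
  | n + 1, h => pathSum G n (Fin.init h) + G n (Fin.init h) (h (Fin.last n))

theorem measurable_pathSum {E : Type*} [MeasurableSpace E] {G : (n : ℕ) → (Fin n → E) → E → ℝ}
    (hG : ∀ n, Measurable (Function.uncurry (G n))) (n : ℕ) : Measurable (pathSum G n) := by
  induction n with
  | zero => exact measurable_const
  | succ n ih =>
    have hi : Measurable (Fin.init : (Fin (n + 1) → E) → Fin n → E) :=
      measurable_pi_lambda _ fun i => measurable_pi_apply i.castSucc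
    exact (ih.comp hi).add ((hG n).comp (hi.prodMk (measurable_pi_apply (Fin.last n))))

theorem pathSum_history {X A Ω : Type*} {x : ℕ → Ω → X} {r : ℕ → Ω → A → I} {a : ℕ → Ω → A}
    (G : (n : ℕ) → (Fin n → X × (A → I) × A) → X × (A → I) × A → ℝ)
    (n : ℕ) (ω : Ω) :
    pathSum G n (history x r a n ω) = ∑ i ∈ range n, G i (history x r a i ω)
      (x (i + 1) ω, r (i + 1) ω, a (i + 1) ω) := by
  induction n with
  | zero => rfl
  | succ n ih => rw [sum_range_succ, ← ih]; rfl

/-! ### Exponential supermartingales along an adaptive run -/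

section Run

variable {X A Ω : Type*} [MeasurableSpace X] [Fintype A] [MeasurableSpace A]
  [MeasurableSpace Ω] {μ : Measure Ω} {D : Measure (X × (A → I))}
  {P : (n : ℕ) → (Fin n → X × (A → I) × A) → X → A → ℝ} {T : ℕ}
  {x : ℕ → Ω → X} {r : ℕ → Ω → A → I} {a : ℕ → Ω → A}

theorem IsAdaptiveRun.measurable_history (H : IsAdaptiveRun μ D P T x r a) (n : ℕ) :
    Measurable (history x r a n) :=
  measurable_pi_lambda _ fun _ =>
    (H.measurable_context _).prodMk ((H.measurable_reward _).prodMk (H.measurable_action _))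

/-- Splitting on the value of the new action turns its indicator into the policy's probability;
independence then separates the past from the fresh draw of context and rewards. With values in [0,
∞] no integrability has to be checked. -/
theorem IsAdaptiveRun.lintegral_step [DiscreteMeasurableSpace A] [IsProbabilityMeasure μ]
    [IsProbabilityMeasure D]
    (H : IsAdaptiveRun μ D P T x r a) {n : ℕ} (hn : n < T)
    {k : (Fin n → X × (A → I) × A) → X × (A → I) × A → ℝ≥0∞}
    (hk : Measurable (Function.uncurry k)) :
    ∫⁻ ω, k (history x r a n ω) (x (n + 1) ω, r (n + 1) ω, a (n + 1) ω) ∂μ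
      = ∫⁻ ω, ∫⁻ z, ∑ b, ENNReal.ofReal (P n (history x r a n ω) z.1 b) *
          k (history x r a n ω) (z.1, z.2, b) ∂D ∂μ := by
  classical
  have hZ : Measurable fun ω => (x (n + 1) ω, r (n + 1) ω) :=
    (H.measurable_context _).prodMk (H.measurable_reward _)
  have hH := H.measurable_history n
  have hB : ∀ b, MeasurableSet {ω | a (n + 1) ω = b} := fun b =>
    H.measurable_action (n + 1) (measurableSet_singleton b)
  have hkb : ∀ b, Measurable fun y : (Fin n → X × (A → I) × A) × X × (A → I) =>
      k y.1 (y.2.1, y.2.2, b) := fun b => hk.comp (by fun_prop : Measurable fun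
      y : (Fin n → X × (A → I) × A) × X × (A → I) => (y.1, (y.2.1, y.2.2, b)))
  have hPb : ∀ b, Measurable fun y : (Fin n → X × (A → I) × A) × X × (A → I) =>
      P n y.1 y.2.1 b := fun b =>
    (H.measurable_policy n b).comp (by fun_prop : Measurable fun
      y : (Fin n → X × (A → I) × A) × X × (A → I) => (y.1, y.2.1))
  have hsum : Measurable fun y : (Fin n → X × (A → I) × A) × X × (A → I) =>
      ∑ b, ENNReal.ofReal (P n y.1 y.2.1 b) * k y.1 (y.2.1, y.2.2, b) :=
    Finset.measurable_sum _ fun b _ => (hPb b).ennreal_ofReal.mul (hkb b)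
  calc ∫⁻ ω, k (history x r a n ω) (x (n + 1) ω, r (n + 1) ω, a (n + 1) ω) ∂μ
      = ∫⁻ ω, ∑ b, ({ω | a (n + 1) ω = b}).indicator
          (fun ω => k (history x r a n ω) (x (n + 1) ω, r (n + 1) ω, b)) ω ∂μ := by
        refine lintegral_congr fun ω => ?_
        rw [Finset.sum_eq_single (a (n + 1) ω)]
        · simp
        · intro b _ hb
          simp [Set.indicator, hb.symm]
        · simp
    _ = ∑ b, ∫⁻ ω, ENNReal.ofReal (P n (history x r a n ω) (x (n + 1) ω) b) *
          k (history x r a n ω) (x (n + 1) ω, r (n + 1) ω, b) ∂μ := by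
        rw [lintegral_finsetSum]
        · refine Finset.sum_congr rfl fun b _ => ?_
          rw [lintegral_indicator (hB b)]
          exact setLIntegral_comp_eq_of_condExp_indicator (hH.prodMk hZ) (hB b) (hPb b)
            (fun y => (H.policy n y.1).nonneg _ _) (H.action n hn b) (hkb b)
        · exact fun b _ => ((hkb b).comp (hH.prodMk hZ)).indicator (hB b)
    _ = ∫⁻ ω, ∑ b, ENNReal.ofReal (P n (history x r a n ω) (x (n + 1) ω) b) *
          k (history x r a n ω) (x (n + 1) ω, r (n + 1) ω, b) ∂μ := by
        rw [lintegral_finsetSum]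
        exact fun b _ => ((hPb b).comp (hH.prodMk hZ)).ennreal_ofReal.mul
          ((hkb b).comp (hH.prodMk hZ))
    _ = ∫⁻ y, ∑ b, ENNReal.ofReal (P n y.1 y.2.1 b) * k y.1 (y.2.1, y.2.2, b)
          ∂(μ.map fun ω => (history x r a n ω, (x (n + 1) ω, r (n + 1) ω))) := by
        rw [lintegral_map hsum (hH.prodMk hZ)]
    _ = _ := by
        rw [(indepFun_iff_map_prod_eq_prod_map_map hH.aemeasurable hZ.aemeasurable).1
          (H.indep n hn).symm, H.law n hn, lintegral_prod _ hsum.aemeasurable,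
          lintegral_map hsum.lintegral_prod_right' hH]

/-- Exponential supermartingales have expectation at most `1`. -/
theorem IsAdaptiveRun.lintegral_exp_le_one [DiscreteMeasurableSpace A] [IsProbabilityMeasure μ]
    [IsProbabilityMeasure D] (H : IsAdaptiveRun μ D P T x r a)
    {G : (n : ℕ) → (Fin n → X × (A → I) × A) → X × (A → I) × A → ℝ}
    (hG : ∀ n, Measurable (Function.uncurry (G n)))
    (hle : ∀ n h, ∫⁻ z, ∑ b, ENNReal.ofReal (P n h z.1 b) *
      ENNReal.ofReal (Real.exp (G n h (z.1, z.2, b))) ∂D ≤ 1) {n : ℕ} (hn : n ≤ T) :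
    ∫⁻ ω, ENNReal.ofReal (Real.exp (∑ i ∈ range n, G i (history x r a i ω)
      (x (i + 1) ω, r (i + 1) ω, a (i + 1) ω))) ∂μ ≤ 1 := by
  induction n with
  | zero => simp
  | succ n ih =>
    have hk : Measurable (Function.uncurry fun (h : Fin n → X × (A → I) × A)
        (e : X × (A → I) × A) => ENNReal.ofReal (Real.exp (pathSum G n h)) *
          ENNReal.ofReal (Real.exp (G n h e))) :=
      ((measurable_pathSum hG n).comp measurable_fst).exp.ennreal_ofReal.mul
        (hG n).exp.ennreal_ofReal
    calc ∫⁻ ω, ENNReal.ofReal (Real.exp (∑ i ∈ range (n + 1), G i (history x r a i ω)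
          (x (i + 1) ω, r (i + 1) ω, a (i + 1) ω))) ∂μ
        = ∫⁻ ω, ENNReal.ofReal (Real.exp (pathSum G n (history x r a n ω))) *
            ENNReal.ofReal (Real.exp (G n (history x r a n ω)
              (x (n + 1) ω, r (n + 1) ω, a (n + 1) ω))) ∂μ := by
          refine lintegral_congr fun ω => ?_
          rw [sum_range_succ, Real.exp_add, ENNReal.ofReal_mul (Real.exp_nonneg _),
            pathSum_history]
      _ ≤ ∫⁻ ω, ENNReal.ofReal (Real.exp (pathSum G n (history x r a n ω))) ∂μ := by
          rw [H.lintegral_step (by omega) hk]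
          refine lintegral_mono fun ω => ?_
          -- The exponential of the past sum depends on the history only, so it leaves the inner
          -- integral, and `hle` bounds what remains for each fixed history.
          simp only [mul_left_comm _ (ENNReal.ofReal (Real.exp (pathSum G n _))), ← mul_sum]
          rw [lintegral_const_mul' _ _ ENNReal.ofReal_ne_top]
          exact mul_le_of_le_one_right' (hle n _)
      _ ≤ 1 := by
          simpa only [pathSum_history] using ih (by omega)

/-- The Markov inequality for exponential supermartingales. -/
theorem IsAdaptiveRun.measure_lt_sum_le [DiscreteMeasurableSpace A] [IsProbabilityMeasure μ]
    [IsProbabilityMeasure D] (H : IsAdaptiveRun μ D P T x r a)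
    {G : (n : ℕ) → (Fin n → X × (A → I) × A) → X × (A → I) × A → ℝ}
    (hG : ∀ n, Measurable (Function.uncurry (G n)))
    (hle : ∀ n h, ∫⁻ z, ∑ b, ENNReal.ofReal (P n h z.1 b) *
      ENNReal.ofReal (Real.exp (G n h (z.1, z.2, b))) ∂D ≤ 1) {n : ℕ} (hn : n ≤ T)
    {ε : ℝ} (hε : 0 < ε) :
    μ {ω | Real.log (1 / ε) < ∑ i ∈ range n, G i (history x r a i ω)
      (x (i + 1) ω, r (i + 1) ω, a (i + 1) ω)} ≤ ENNReal.ofReal ε := by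
  have hm : Measurable fun ω => ENNReal.ofReal (Real.exp (∑ i ∈ range n, G i (history x r a i ω)
      (x (i + 1) ω, r (i + 1) ω, a (i + 1) ω))) := by
    simp only [← pathSum_history]
    exact ((measurable_pathSum hG n).comp (H.measurable_history n)).exp.ennreal_ofReal
  have h1 : μ {ω | ENNReal.ofReal (1 / ε) ≤ ENNReal.ofReal (Real.exp (∑ i ∈ range n,
      G i (history x r a i ω) (x (i + 1) ω, r (i + 1) ω, a (i + 1) ω)))}
      ≤ 1 / ENNReal.ofReal (1 / ε) :=
    (meas_ge_le_lintegral_div hm.aemeasurable (by simpa using hε)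
      ENNReal.ofReal_ne_top).trans (ENNReal.div_le_div_right (H.lintegral_exp_le_one hG hle hn) _)
  refine (measure_mono fun ω hω => ?_).trans (h1.trans_eq ?_)
  · have h2 := Real.exp_lt_exp.2 (Set.mem_ofPred_eq ▸ hω :)
    rw [Real.exp_log (by positivity)] at h2
    exact ENNReal.ofReal_le_ofReal h2.le
  · rw [one_div, one_div, ENNReal.ofReal_inv_of_pos hε, inv_inv]

end Run

/-! ### Means under a randomized policy -/

section Mean

variable {X A : Type*} [MeasurableSpace X] [Fintype A] {ν : Measure X} {q : X → A → ℝ}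
  {u v : X → A → ℝ}

/-- The expectation of `u` when the context is drawn from `ν` and the action from `q`. -/
def mean (ν : Measure X) (q u : X → A → ℝ) : ℝ := ∫ x, ∑ b, q x b * u x b ∂ν

theorem IsStochasticPolicy.sum_mul_le (hq : IsStochasticPolicy q) {C : ℝ} {x : X}
    (h : ∀ b, u x b ≤ C) : ∑ b, q x b * u x b ≤ C :=
  calc ∑ b, q x b * u x b ≤ ∑ b, q x b * C :=
        sum_le_sum fun b _ => mul_le_mul_of_nonneg_left (h b) (hq.nonneg x b)
    _ = C := by rw [← sum_mul, hq.sum_eq_one, one_mul]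

theorem IsStochasticPolicy.le_sum_mul (hq : IsStochasticPolicy q) {C : ℝ} {x : X}
    (h : ∀ b, C ≤ u x b) : C ≤ ∑ b, q x b * u x b :=
  calc C = ∑ b, q x b * C := by rw [← sum_mul, hq.sum_eq_one, one_mul]
    _ ≤ ∑ b, q x b * u x b :=
        sum_le_sum fun b _ => mul_le_mul_of_nonneg_left (h b) (hq.nonneg x b)

theorem IsStochasticPolicy.le_one (hq : IsStochasticPolicy q) (x : X) (b : A) : q x b ≤ 1 :=
  (single_le_sum (fun c _ => hq.nonneg x c) (mem_univ b)).trans_eq (hq.sum_eq_one x)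

theorem IsStochasticPolicy.measurable_sum_mul (hq : IsStochasticPolicy q)
    (hu : ∀ b, Measurable fun x => u x b) : Measurable fun x => ∑ b, q x b * u x b :=
  Finset.measurable_sum _ fun b _ => (hq.measurable b).mul (hu b)

theorem IsStochasticPolicy.integrable [IsFiniteMeasure ν] (hq : IsStochasticPolicy q)
    (hu : ∀ b, Measurable fun x => u x b) {C : ℝ} (hC : ∀ x b, |u x b| ≤ C) :
    Integrable (fun x => ∑ b, q x b * u x b) ν :=
  Integrable.of_bound (hq.measurable_sum_mul hu).aestronglyMeasurable C <|
    ae_of_all _ fun x => abs_le.2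
      ⟨hq.le_sum_mul fun b => (abs_le.1 (hC x b)).1, hq.sum_mul_le fun b => (abs_le.1 (hC x b)).2⟩

theorem IsStochasticPolicy.mean_mono [IsFiniteMeasure ν] (hq : IsStochasticPolicy q)
    (hu : ∀ b, Measurable fun x => u x b) {C : ℝ} (hC : ∀ x b, |u x b| ≤ C)
    (hv : ∀ b, Measurable fun x => v x b) {C' : ℝ} (hC' : ∀ x b, |v x b| ≤ C')
    (h : ∀ x b, u x b ≤ v x b) : mean ν q u ≤ mean ν q v :=
  integral_mono (hq.integrable hu hC) (hq.integrable hv hC') fun x =>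
    sum_le_sum fun b _ => mul_le_mul_of_nonneg_left (h x b) (hq.nonneg x b)

theorem IsStochasticPolicy.mean_add [IsFiniteMeasure ν] (hq : IsStochasticPolicy q)
    (hu : ∀ b, Measurable fun x => u x b) {C : ℝ} (hC : ∀ x b, |u x b| ≤ C)
    (hv : ∀ b, Measurable fun x => v x b) {C' : ℝ} (hC' : ∀ x b, |v x b| ≤ C') :
    mean ν q (fun x b => u x b + v x b) = mean ν q u + mean ν q v := by
  unfold mean
  rw [← integral_add (hq.integrable hu hC) (hq.integrable hv hC')]
  simp only [mul_add, sum_add_distrib]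

theorem mean_const_mul (c : ℝ) : mean ν q (fun x b => c * u x b) = c * mean ν q u := by
  unfold mean
  rw [← integral_const_mul]
  simp only [mul_sum, mul_left_comm]

theorem IsStochasticPolicy.mean_const [IsProbabilityMeasure ν] (hq : IsStochasticPolicy q)
    (c : ℝ) : mean ν q (fun _ _ => c) = c := by
  simp [mean, ← sum_mul, hq.sum_eq_one]

theorem mean_comp {S : Type*} [MeasurableSpace S] {D : Measure S} {φ : S → X} (hφ : Measurable φ)
    (hq : IsStochasticPolicy q) (hu : ∀ b, Measurable fun x => u x b) :
    mean D (fun z => q (φ z)) (fun z => u (φ z)) = mean (D.map φ) q u :=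
  (integral_map hφ.aemeasurable (hq.measurable_sum_mul hu).aestronglyMeasurable).symm

theorem IsStochasticPolicy.comp {S : Type*} [MeasurableSpace S] {φ : S → X} (hφ : Measurable φ)
    (hq : IsStochasticPolicy q) : IsStochasticPolicy fun z => q (φ z) :=
  ⟨fun _ => hq.nonneg _, fun _ => hq.sum_eq_one _, fun b => (hq.measurable b).comp hφ⟩

/-- A bound for the exponential moment of a bounded variable by its first two moments. -/
theorem IsStochasticPolicy.lintegral_exp_le_one [IsProbabilityMeasure ν]
    (hq : IsStochasticPolicy q) (hu : ∀ b, Measurable fun x => u x b) (hu1 : ∀ x b, |u x b| ≤ 1)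
    {c : ℝ} (hc : mean ν q (fun x b => u x b + u x b ^ 2) ≤ c) :
    ∫⁻ x, ∑ b, ENNReal.ofReal (q x b) * ENNReal.ofReal (Real.exp (u x b - c)) ∂ν ≤ 1 := by
  have hv : ∀ b, Measurable fun x => u x b + u x b ^ 2 := fun b => (hu b).add ((hu b).pow_const 2)
  have hvb : ∀ x b, |u x b + u x b ^ 2| ≤ 2 := fun x b => by
    have := abs_le.1 (hu1 x b)
    rw [abs_le]
    constructor <;> nlinarith
  have hint := hq.integrable (ν := ν) hv hvb
  have hpt : ∀ x, ∑ b, ENNReal.ofReal (q x b) * ENNReal.ofReal (Real.exp (u x b - c))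
      ≤ ENNReal.ofReal (Real.exp (-c) * (1 + ∑ b, q x b * (u x b + u x b ^ 2))) := fun x => by
    simp only [← ENNReal.ofReal_mul (hq.nonneg x _)]
    rw [← ENNReal.ofReal_sum_of_nonneg fun b _ =>
      mul_nonneg (hq.nonneg x b) (Real.exp_nonneg _)]
    refine ENNReal.ofReal_le_ofReal ?_
    rw [← hq.sum_eq_one x, ← sum_add_distrib, mul_sum]
    refine sum_le_sum fun b _ => ?_
    -- The bound rests on exp u ≤ 1 + u + u² for |u| ≤ 1, followed by 1 + c ≤ exp c after
    -- integration.
    have h1 := abs_le.1 (Real.abs_exp_sub_one_sub_id_le (hu1 x b))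
    have h2 : Real.exp (u x b - c) = Real.exp (-c) * Real.exp (u x b) := by
      rw [← Real.exp_add]; ring_nf
    rw [h2]
    nlinarith [mul_le_mul_of_nonneg_left (by linarith : Real.exp (u x b) ≤ 1 + u x b + u x b ^ 2)
      (mul_nonneg (hq.nonneg x b) (Real.exp_nonneg (-c)))]
  refine (lintegral_mono hpt).trans ?_
  have hint' : Integrable (fun x => Real.exp (-c) * (1 + ∑ b, q x b * (u x b + u x b ^ 2))) ν :=
    ((integrable_const 1).add hint).const_mul _
  rw [← ofReal_integral_eq_lintegral_ofReal hint']
  · rw [ENNReal.ofReal_le_one]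
    have h3 : ∫ x, Real.exp (-c) * (1 + ∑ b, q x b * (u x b + u x b ^ 2)) ∂ν
        = Real.exp (-c) * (1 + mean ν q (fun x b => u x b + u x b ^ 2)) := by
      rw [integral_const_mul, integral_add (integrable_const 1) hint]
      simp [mean]
    rw [h3]
    calc _ ≤ Real.exp (-c) * Real.exp c := by
          gcongr
          linarith [Real.add_one_le_exp c]
      _ = 1 := by rw [← Real.exp_add]; simp
  · refine ae_of_all _ fun x => mul_nonneg (Real.exp_nonneg _) ?_
    have := hq.le_sum_mul (u := fun x b => u x b + u x b ^ 2) (C := -1) (x := x) fun b => by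
      nlinarith [sq_nonneg (u x b + 1 / 2)]
    show 0 ≤ 1 + _
    linarith

end Mean

/-! ### Replacing rewards by their conditional means -/

section Realizable

variable {X A : Type*} [MeasurableSpace X] {D : Measure (X × (A → I))} [IsProbabilityMeasure D]
  {fstar : X → A → I}

theorem abs_sub_le_one (s t : I) : |(s : ℝ) - t| ≤ 1 := by
  rw [abs_le]
  constructor <;> linarith [s.2.1, s.2.2, t.2.1, t.2.2]

/-- A weight that depends on the context alone can be pulled out of the conditional expectation
given the context. -/
theorem Realizes.integral_mul (hf : Realizes D fstar) {w : X → ℝ} (hw : Measurable w) {C : ℝ}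
    (hC : ∀ x, |w x| ≤ C) (b : A) :
    ∫ z, w z.1 * (z.2 b : ℝ) ∂D = ∫ z, w z.1 * (fstar z.1 b : ℝ) ∂D := by
  have hm : MeasurableSpace.comap Prod.fst inferInstance
      ≤ (inferInstance : MeasurableSpace (X × (A → I))) := measurable_fst.comap_le
  have hr : Measurable fun z : X × (A → I) => (z.2 b : ℝ) :=
    measurable_subtype_coe.comp ((measurable_pi_apply b).comp measurable_snd)
  have hri : Integrable (fun z : X × (A → I) => (z.2 b : ℝ)) D :=
    Integrable.of_bound hr.aestronglyMeasurable 1 <| ae_of_all _ fun z => by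
      rw [Real.norm_eq_abs, abs_of_nonneg (z.2 b).2.1]
      exact (z.2 b).2.2
  have hwi : Integrable (fun z : X × (A → I) => w z.1 * (z.2 b : ℝ)) D :=
    hri.bdd_mul (hw.comp measurable_fst).aestronglyMeasurable (ae_of_all _ fun z => hC z.1)
  have hws : StronglyMeasurable[MeasurableSpace.comap Prod.fst inferInstance]
      fun z : X × (A → I) => w z.1 :=
    (hw.comp (comap_measurable Prod.fst)).stronglyMeasurable
  rw [← integral_condExp hm]
  refine integral_congr_ae ?_
  filter_upwards [condExp_mul_of_stronglyMeasurable_left hws hwi hri, hf b] with z h1 h2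
  refine h1.trans ?_
  rw [Pi.mul_apply, h2]

theorem Realizes.integral_sum_mul [Fintype A] (hf : Realizes D fstar) (hfm : Measurable fstar)
    {w : X → A → ℝ} (hw : ∀ b, Measurable fun x => w x b) {C : ℝ} (hC : ∀ x b, |w x b| ≤ C) :
    ∫ z, ∑ b, w z.1 b * (z.2 b : ℝ) ∂D = ∫ z, ∑ b, w z.1 b * (fstar z.1 b : ℝ) ∂D := by
  have hint : ∀ b (g : X × (A → I) → I), Measurable g →
      Integrable (fun z : X × (A → I) => w z.1 b * (g z : ℝ)) D := fun b g hg =>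
    (Integrable.of_bound (measurable_subtype_coe.comp hg).aestronglyMeasurable 1 <|
      ae_of_all _ fun z => by
        rw [Real.norm_eq_abs, Function.comp_apply, abs_of_nonneg (g z).2.1]
        exact (g z).2.2).bdd_mul
      ((hw b).comp measurable_fst).aestronglyMeasurable (ae_of_all _ fun z => hC z.1 b)
  rw [integral_finsetSum _ fun b _ => hint b (fun z => z.2 b)
      ((measurable_pi_apply b).comp measurable_snd),
    integral_finsetSum _ fun b _ => hint b (fun z => fstar z.1 b)
      ((measurable_pi_apply b).comp (hfm.comp measurable_fst))]
  exact sum_congr rfl fun b _ => hf.integral_mul (hw b) (fun x => hC x b) b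

end Realizable

/-! ### Concentration of squared losses and of the regret -/

section Concentration

variable {X A Ω : Type*} [MeasurableSpace X] [Fintype A] [MeasurableSpace A]
  [MeasurableSpace Ω] {μ : Measure Ω} {D : Measure (X × (A → I))}
  {P : (n : ℕ) → (Fin n → X × (A → I) × A) → X → A → ℝ} {T : ℕ}
  {x : ℕ → Ω → X} {r : ℕ → Ω → A → I} {a : ℕ → Ω → A} {f fstar : X → A → I} {q : X → A → ℝ}

/-- The mean squared difference of two predictors. -/
def sqErr {X A : Type*} [MeasurableSpace X] [Fintype A] (ν : Measure X) (f g : X → A → I)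
    (q : X → A → ℝ) : ℝ :=
  mean ν q fun x b => ((f x b : ℝ) - g x b) ^ 2

/-- The regret of the randomized policy `q` against `π`, if `f` is the mean reward. -/
def meanRegret {X A : Type*} [MeasurableSpace X] [Fintype A] (ν : Measure X) (f : X → A → I)
    (π : X → A) (q : X → A → ℝ) : ℝ :=
  mean ν q fun x b => (f x (π x) : ℝ) - f x b

theorem measurable_eval_action {X A : Type*} [MeasurableSpace X] [Countable A]
    [MeasurableSpace A] [DiscreteMeasurableSpace A]
    {f : X → A → I} (hf : Measurable f) {π : X → A} (hπ : Measurable π) :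
    Measurable fun x => f x (π x) := by
  have h : Measurable fun y : A × X => f y.2 y.1 :=
    measurable_from_prod_countable_right fun b => (measurable_pi_apply b).comp hf
  exact h.comp (hπ.prodMk measurable_id)

theorem measurable_apply_action {X A : Type*} [MeasurableSpace X] [Countable A]
    [MeasurableSpace A] [DiscreteMeasurableSpace A]
    {f : X → A → I} (hf : Measurable f) {π : X → A} (hπ : Measurable π) :
    Measurable fun x => (f x (π x) : ℝ) :=
  measurable_subtype_coe.comp (measurable_eval_action hf hπ)

theorem measurable_coe_apply {X A : Type*} [MeasurableSpace X] {f : X → A → I}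
    (hf : Measurable f) (b : A) : Measurable fun x => (f x b : ℝ) :=
  measurable_subtype_coe.comp ((measurable_pi_apply b).comp hf)

theorem IsAdaptiveRun.measurable_mean [SFinite D] (H : IsAdaptiveRun μ D P T x r a)
    {u : X → A → ℝ} (hu : ∀ b, Measurable fun x => u x b) (n : ℕ) :
    Measurable fun h => mean (D.map Prod.fst) (P n h) u := by
  have h1 : Measurable fun y : (Fin n → X × (A → I) × A) × X => ∑ b, P n y.1 y.2 b * u y.2 b :=
    Finset.measurable_sum _ fun b _ => (H.measurable_policy n b).mul ((hu b).comp measurable_snd)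
  exact h1.stronglyMeasurable.integral_prod_right.measurable

/-- The noise `z.2 b - fstar z.1 b` has conditional mean zero given the context, and its coefficient
here is a function of the context. This removes the cross term of the excess squared loss. -/
theorem Realizes.mean_mul_sub {X A : Type*} [MeasurableSpace X] [Fintype A] {D : Measure (X × (A → I))}
    {f fstar : X → A → I} {q : X → A → ℝ} [IsProbabilityMeasure D]
    (hreal : Realizes D fstar) (hfs : Measurable fstar) (hf : Measurable f)
    (hq : IsStochasticPolicy q) :
    mean D (fun z => q z.1)
      (fun z b => ((f z.1 b : ℝ) - fstar z.1 b) * (z.2 b - fstar z.1 b)) = 0 := by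
  have hq' : IsStochasticPolicy fun z : X × (A → I) => q z.1 := hq.comp measurable_fst
  have hfm : ∀ b, Measurable fun z : X × (A → I) => (f z.1 b : ℝ) := fun b =>
    (measurable_coe_apply hf b).comp measurable_fst
  have hfsm : ∀ b, Measurable fun z : X × (A → I) => (fstar z.1 b : ℝ) := fun b =>
    (measurable_coe_apply hfs b).comp measurable_fst
  have hrm : ∀ b, Measurable fun z : X × (A → I) => (z.2 b : ℝ) :=
    measurable_coe_apply measurable_snd
  have hw : ∀ b, Measurable fun x => q x b * ((f x b : ℝ) - fstar x b) := fun b =>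
    (hq.measurable b).mul ((measurable_coe_apply hf b).sub (measurable_coe_apply hfs b))
  have hwC : ∀ x b, |q x b * ((f x b : ℝ) - fstar x b)| ≤ 1 := fun x b => by
    rw [abs_mul, abs_of_nonneg (hq.nonneg x b)]
    exact mul_le_one₀ (hq.le_one x b) (abs_nonneg _) (abs_sub_le_one _ _)
  have h1 := hreal.integral_sum_mul hfs hw hwC
  have hint : ∀ g : X × (A → I) → A → I, (∀ b, Measurable fun z => (g z b : ℝ)) →
      Integrable (fun z : X × (A → I) => ∑ b, q z.1 b * ((f z.1 b : ℝ) - fstar z.1 b) * g z b)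
        D := fun g hg => by
    simp only [mul_assoc]
    refine hq'.integrable (u := fun z b => ((f z.1 b : ℝ) - fstar z.1 b) * g z b) (C := 1)
      (fun b => ((hfm b).sub (hfsm b)).mul (hg b)) fun z b => ?_
    rw [abs_mul]
    refine mul_le_one₀ (abs_sub_le_one _ _) (abs_nonneg _) ?_
    rw [abs_of_nonneg (g z b).2.1]
    exact (g z b).2.2
  have h2 := integral_sub (hint (fun z => z.2) hrm) (hint (fun z => fstar z.1) hfsm)
  rw [h1, sub_self] at h2
  rw [← h2, mean]
  refine integral_congr_ae (ae_of_all _ fun z => ?_)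
  simp only [← sum_sub_distrib]
  exact sum_congr rfl fun b _ => by ring

theorem abs_excess_le_one (s t w : I) :
    |(1 / 8) * (((s : ℝ) - w) ^ 2 - ((t : ℝ) - w) ^ 2)| ≤ 1 := by
  have h1 := (sq_le_one_iff_abs_le_one _).2 (abs_sub_le_one s w)
  have h2 := (sq_le_one_iff_abs_le_one _).2 (abs_sub_le_one t w)
  rw [abs_le]
  constructor <;> linarith [sq_nonneg ((s : ℝ) - w), sq_nonneg ((t : ℝ) - w)]

theorem abs_sub_mul_sub_le_one (s t w : I) : |((s : ℝ) - t) * (w - t)| ≤ 1 := by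
  rw [abs_mul]
  exact mul_le_one₀ (abs_sub_le_one _ _) (abs_nonneg _) (abs_sub_le_one _ _)

theorem abs_sq_sub_le_one (s t : I) : |((s : ℝ) - t) ^ 2| ≤ 1 := by
  rw [abs_pow]
  exact pow_le_one₀ (abs_nonneg _) (abs_sub_le_one _ _)

/-- With s the value of `fstar`, t that of f and w the reward, (s-w)² - (t-w)² = -(t-s)² +
2(t-s)(w-s). It also factors as (s-t)(s+t-2w), with |s+t-2w| ≤ 2. At scale 1/8 the square therefore
costs at most half of the negative drift -(t-s)²/8. -/
theorem excess_add_sq_le (s t w : I) :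
    (1 / 8) * (((s : ℝ) - w) ^ 2 - ((t : ℝ) - w) ^ 2)
      + ((1 / 8) * (((s : ℝ) - w) ^ 2 - ((t : ℝ) - w) ^ 2)) ^ 2
      ≤ -(1 / 16) * ((t : ℝ) - s) ^ 2 + (1 / 4) * (((t : ℝ) - s) * (w - s)) := by
  have h1 : ((t : ℝ) + s - 2 * w) ^ 2 ≤ 4 := by
    have ha := abs_le.1 (abs_sub_le_one t w)
    have hb := abs_le.1 (abs_sub_le_one s w)
    nlinarith
  nlinarith [mul_le_mul_of_nonneg_left h1 (sq_nonneg ((t : ℝ) - s))]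

/-- The one-round supermartingale condition: after the pointwise bound `excess_add_sq_le` the cross
term integrates to zero, and only the drift -1/16 times the squared error is left. -/
theorem Realizes.lintegral_exp_squaredLoss_le_one
    {X A : Type*} [MeasurableSpace X] [Fintype A] {D : Measure (X × (A → I))}
    {f fstar : X → A → I} {q : X → A → ℝ} [IsProbabilityMeasure D]
    (hreal : Realizes D fstar) (hfs : Measurable fstar) (hf : Measurable f)
    (hq : IsStochasticPolicy q) :
    ∫⁻ z, ∑ b, ENNReal.ofReal (q z.1 b) * ENNReal.ofReal (Real.exp
      ((1 / 8) * ((fstar z.1 b - z.2 b) ^ 2 - (f z.1 b - z.2 b) ^ 2)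
        - (-(1 / 16) * sqErr (D.map Prod.fst) f fstar q))) ∂D ≤ 1 := by
  have hq' : IsStochasticPolicy fun z : X × (A → I) => q z.1 := hq.comp measurable_fst
  have hfm : ∀ b, Measurable fun z : X × (A → I) => (f z.1 b : ℝ) := fun b =>
    (measurable_coe_apply hf b).comp measurable_fst
  have hfsm : ∀ b, Measurable fun z : X × (A → I) => (fstar z.1 b : ℝ) := fun b =>
    (measurable_coe_apply hfs b).comp measurable_fst
  have hrm : ∀ b, Measurable fun z : X × (A → I) => (z.2 b : ℝ) :=
    measurable_coe_apply measurable_snd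
  have hum : ∀ b, Measurable fun z : X × (A → I) =>
      (1 / 8) * (((fstar z.1 b : ℝ) - z.2 b) ^ 2 - ((f z.1 b : ℝ) - z.2 b) ^ 2) := fun b =>
    ((((hfsm b).sub (hrm b)).pow_const 2).sub (((hfm b).sub (hrm b)).pow_const 2)).const_mul _
  have hsm : ∀ b, Measurable fun z : X × (A → I) =>
      -(1 / 16) * ((f z.1 b : ℝ) - fstar z.1 b) ^ 2 := fun b =>
    (((hfm b).sub (hfsm b)).pow_const 2).const_mul _
  have hcm : ∀ b, Measurable fun z : X × (A → I) =>
      (1 / 4) * (((f z.1 b : ℝ) - fstar z.1 b) * (z.2 b - fstar z.1 b)) := fun b =>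
    (((hfm b).sub (hfsm b)).mul ((hrm b).sub (hfsm b))).const_mul _
  have hsb : ∀ (z : X × (A → I)) b, |-(1 / 16) * ((f z.1 b : ℝ) - fstar z.1 b) ^ 2| ≤ 1 :=
    fun z b => by
      have := abs_le.1 (abs_sq_sub_le_one (f z.1 b) (fstar z.1 b))
      rw [abs_le]
      constructor <;> linarith
  have hcb : ∀ (z : X × (A → I)) b,
      |(1 / 4) * (((f z.1 b : ℝ) - fstar z.1 b) * (z.2 b - fstar z.1 b))| ≤ 1 := fun z b => by
    have := abs_le.1 (abs_sub_mul_sub_le_one (f z.1 b) (fstar z.1 b) (z.2 b))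
    rw [abs_le]
    constructor <;> linarith
  refine hq'.lintegral_exp_le_one (ν := D) (c := -(1 / 16) * sqErr (D.map Prod.fst) f fstar q)
    (u := fun z b => (1 / 8) * (((fstar z.1 b : ℝ) - z.2 b) ^ 2 - ((f z.1 b : ℝ) - z.2 b) ^ 2))
    hum (fun z b => abs_excess_le_one _ _ _) ?_
  refine (hq'.mean_mono (C := 2) (C' := 2)
    (v := fun z b => -(1 / 16) * ((f z.1 b : ℝ) - fstar z.1 b) ^ 2
      + (1 / 4) * (((f z.1 b : ℝ) - fstar z.1 b) * (z.2 b - fstar z.1 b)))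
    (fun b => (hum b).add ((hum b).pow_const 2))
    (fun z b => ?_) (fun b => (hsm b).add (hcm b))
    (fun z b => (abs_add_le _ _).trans (by linarith [hsb z b, hcb z b]))
    (fun z b => excess_add_sq_le _ _ _)).trans_eq ?_
  · have h1 := abs_excess_le_one (fstar z.1 b) (f z.1 b) (z.2 b)
    refine (abs_add_le _ _).trans ?_
    rw [abs_pow]
    linarith [pow_le_one₀ (n := 2) (abs_nonneg _) h1]
  · have hDm : ∀ b, Measurable fun x => ((f x b : ℝ) - fstar x b) ^ 2 := fun b =>
      ((measurable_coe_apply hf b).sub (measurable_coe_apply hfs b)).pow_const 2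
    rw [hq'.mean_add hsm hsb hcm hcb, mean_const_mul, mean_const_mul,
      hreal.mean_mul_sub hfs hf hq, sqErr, ← mean_comp measurable_fst hq hDm, mul_zero, add_zero]

/-- The mean gap is linear in the reward vector, with coefficients `1_{π x = b} - q x b` that depend
on the context alone, so realizability applies coordinate by coordinate. -/
theorem Realizes.mean_regret [DiscreteMeasurableSpace A]
    [IsProbabilityMeasure D] (hreal : Realizes D fstar) (hfs : Measurable fstar) {π : X → A}
    (hπ : Measurable π) (hq : IsStochasticPolicy q) :
    mean D (fun z => q z.1) (fun z b => (z.2 (π z.1) : ℝ) - z.2 b)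
      = meanRegret (D.map Prod.fst) fstar π q := by
  classical
  have hfm : ∀ b, Measurable fun x => (fstar x (π x) : ℝ) - fstar x b := fun b =>
    (measurable_apply_action hfs hπ).sub (measurable_coe_apply hfs b)
  have hw : ∀ b, Measurable fun x => (if π x = b then (1 : ℝ) else 0) - q x b := fun b =>
    (Measurable.ite (hπ (measurableSet_singleton b)) measurable_const measurable_const).sub
      (hq.measurable b)
  have hwC : ∀ x b, |(if π x = b then (1 : ℝ) else 0) - q x b| ≤ 1 := fun x b => by
    have h0 := hq.nonneg x b
    have h1 := hq.le_one x b
    rw [abs_le]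
    split_ifs <;> constructor <;> linarith
  have hsum : ∀ (g : A → I) (x : X), ∑ b, q x b * ((g (π x) : ℝ) - g b)
      = ∑ b, ((if π x = b then (1 : ℝ) else 0) - q x b) * g b := fun g x => by
    simp only [mul_sub, sub_mul, sum_sub_distrib, ← sum_mul, hq.sum_eq_one]
    simp
  rw [meanRegret, ← mean_comp measurable_fst hq hfm]
  simp only [mean, hsum]
  exact hreal.integral_sum_mul hfs hw hwC

theorem IsStochasticPolicy.abs_mean_le {X A : Type*} [MeasurableSpace X] [Fintype A]
    {ν : Measure X} [IsProbabilityMeasure ν] {q u : X → A → ℝ} (hq : IsStochasticPolicy q)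
    (hu : ∀ b, Measurable fun x => u x b) {C : ℝ} (hC : ∀ x b, |u x b| ≤ C) :
    |mean ν q u| ≤ C := by
  rw [abs_le]
  constructor
  · rw [← hq.mean_const (ν := ν) (-C)]
    exact hq.mean_mono (C := |(-C)|) (fun _ => measurable_const) (fun _ _ => le_rfl) hu hC
      fun x b => (abs_le.1 (hC x b)).1
  · conv_rhs => rw [← hq.mean_const (ν := ν) C]
    exact hq.mean_mono hu hC (C' := |C|) (fun _ => measurable_const) (fun _ _ => le_rfl)
      fun x b => (abs_le.1 (hC x b)).2

/-- The centred variable is at most 2 in absolute value, so its multiple by l has mean zero and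
second moment at most 4l²; l ≤ 1/2 keeps it within the range where the exponential is bounded
quadratically. -/
theorem Realizes.lintegral_exp_regret_le_one [DiscreteMeasurableSpace A]
    [IsProbabilityMeasure D] (hreal : Realizes D fstar) (hfs : Measurable fstar) {π : X → A}
    (hπ : Measurable π) (hq : IsStochasticPolicy q) {l : ℝ} (hl0 : 0 ≤ l) (hl : l ≤ 1 / 2) :
    ∫⁻ z, ∑ b, ENNReal.ofReal (q z.1 b) * ENNReal.ofReal (Real.exp
      (l * ((z.2 (π z.1) - z.2 b) - meanRegret (D.map Prod.fst) fstar π q) - 4 * l ^ 2)) ∂D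
      ≤ 1 := by
  have hν : IsProbabilityMeasure (D.map Prod.fst) :=
    Measure.isProbabilityMeasure_map measurable_fst.aemeasurable
  have hq' : IsStochasticPolicy fun z : X × (A → I) => q z.1 := hq.comp measurable_fst
  have hrm : ∀ b, Measurable fun z : X × (A → I) => (z.2 b : ℝ) := fun b =>
    measurable_subtype_coe.comp ((measurable_pi_apply b).comp measurable_snd)
  have hrπ : Measurable fun z : X × (A → I) => (z.2 (π z.1) : ℝ) :=
    measurable_apply_action measurable_snd (hπ.comp measurable_fst)
  have hZm : ∀ b, Measurable fun z : X × (A → I) => (z.2 (π z.1) : ℝ) - z.2 b := fun b =>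
    hrπ.sub (hrm b)
  have hfm : ∀ b, Measurable fun x => (fstar x (π x) : ℝ) - fstar x b := fun b =>
    (measurable_apply_action hfs hπ).sub (measurable_coe_apply hfs b)
  have hmean := hreal.mean_regret hfs hπ hq
  have hρ : |meanRegret (D.map Prod.fst) fstar π q| ≤ 1 :=
    hq.abs_mean_le hfm fun _ _ => abs_sub_le_one _ _
  generalize meanRegret (D.map Prod.fst) fstar π q = ρ at hmean hρ ⊢
  have habs : ∀ (z : X × (A → I)) b, |l * ((z.2 (π z.1) - z.2 b : ℝ) - ρ)| ≤ 2 * l := fun z b => by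
    rw [abs_mul, abs_of_nonneg hl0, mul_comm]
    refine mul_le_mul_of_nonneg_right ((abs_sub _ _).trans ?_) hl0
    linarith [abs_sub_le_one (z.2 (π z.1)) (z.2 b)]
  have hum : ∀ b, Measurable fun z : X × (A → I) => l * ((z.2 (π z.1) - z.2 b : ℝ) - ρ) :=
    fun b => ((hZm b).sub_const _).const_mul _
  refine hq'.lintegral_exp_le_one (ν := D) (c := 4 * l ^ 2)
    (u := fun z b => l * ((z.2 (π z.1) - z.2 b : ℝ) - ρ))
    hum (fun z b => (habs z b).trans (by linarith)) ?_
  have hsq : ∀ (z : X × (A → I)) b, (l * ((z.2 (π z.1) - z.2 b : ℝ) - ρ)) ^ 2 ≤ 4 * l ^ 2 :=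
    fun z b => by
      have := sq_le_sq' (abs_le.1 (habs z b)).1 (abs_le.1 (habs z b)).2
      nlinarith
  have hsqb : ∀ (z : X × (A → I)) b, |(l * ((z.2 (π z.1) - z.2 b : ℝ) - ρ)) ^ 2| ≤ 4 * l ^ 2 :=
    fun z b => by rw [abs_of_nonneg (sq_nonneg _)]; exact hsq z b
  rw [hq'.mean_add hum habs (fun b => (hum b).pow_const 2) hsqb, mean_const_mul]
  have h0 : mean D (fun z => q z.1) (fun z b => (z.2 (π z.1) - z.2 b : ℝ) - ρ) = 0 := by
    simp only [sub_eq_add_neg _ ρ]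
    rw [hq'.mean_add (C := 1) (C' := |ρ|) hZm (fun _ _ => abs_sub_le_one _ _)
      (fun _ => measurable_const) (by simp), hq'.mean_const, hmean, add_neg_cancel]
  rw [h0, mul_zero, zero_add]
  exact (le_abs_self _).trans (hq'.abs_mean_le (fun b => (hum b).pow_const 2) hsqb)

theorem regret_eq_sum_range {X A Ω : Type*} {x : ℕ → Ω → X} {r : ℕ → Ω → A → I} {a : ℕ → Ω → A}
    (π : X → A) (T : ℕ) (ω : Ω) :
    regret π x r a T ω = ∑ i ∈ range T,
      ((r (i + 1) ω (π (x (i + 1) ω)) : ℝ) - (r (i + 1) ω (a (i + 1) ω) : ℝ)) := by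
  rw [regret]
  induction T with
  | zero => simp
  | succ n ih => rw [sum_Icc_succ_top (by omega), sum_range_succ, ih]

/-- The excess squared loss controls the estimation error. -/
theorem IsAdaptiveRun.measure_sqErr_gt_le [DiscreteMeasurableSpace A] [IsProbabilityMeasure μ]
    [IsProbabilityMeasure D] (H : IsAdaptiveRun μ D P T x r a) (hreal : Realizes D fstar)
    (hfs : Measurable fstar) (hf : Measurable f) {n : ℕ} (hn : n ≤ T) {ε : ℝ} (hε : 0 < ε) :
    μ {ω | 2 * (squaredLoss f (observed x r a n ω) - squaredLoss fstar (observed x r a n ω))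
        + 16 * Real.log (1 / ε)
        < ∑ i ∈ range n, sqErr (D.map Prod.fst) f fstar (P i (history x r a i ω))}
      ≤ ENNReal.ofReal ε := by
  have hDm : ∀ b, Measurable fun x => ((f x b : ℝ) - fstar x b) ^ 2 := fun b =>
    ((measurable_coe_apply hf b).sub (measurable_coe_apply hfs b)).pow_const 2
  refine (measure_mono fun ω hω => ?_).trans (H.measure_lt_sum_le
    (G := fun n h e => (1 / 8) * ((fstar e.1 e.2.2 - e.2.1 e.2.2 : ℝ) ^ 2
      - (f e.1 e.2.2 - e.2.1 e.2.2 : ℝ) ^ 2)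
        - (-(1 / 16) * sqErr (D.map Prod.fst) f fstar (P n h))) (fun n => ?_)
    (fun n h => hreal.lintegral_exp_squaredLoss_le_one hfs hf (H.policy n h)) hn hε)
  · have hω' : 2 * (squaredLoss f (observed x r a n ω) - squaredLoss fstar (observed x r a n ω))
        + 16 * Real.log (1 / ε)
        < ∑ i ∈ range n, sqErr (D.map Prod.fst) f fstar (P i (history x r a i ω)) := hω
    show Real.log (1 / ε) < _
    simp only [squaredLoss, observed] at hω'
    rw [Fin.sum_univ_eq_sum_range (fun i => ((f (x (i + 1) ω) (a (i + 1) ω) : ℝ)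
        - (r (i + 1) ω (a (i + 1) ω) : ℝ)) ^ 2) n,
      Fin.sum_univ_eq_sum_range (fun i => ((fstar (x (i + 1) ω) (a (i + 1) ω) : ℝ)
        - (r (i + 1) ω (a (i + 1) ω) : ℝ)) ^ 2) n] at hω'
    simp only [sum_sub_distrib, ← mul_sum]
    linarith
  · have h1 : Measurable fun e : X × (A → I) × A => (fstar e.1 e.2.2 : ℝ) :=
      measurable_apply_action (hfs.comp measurable_fst) (measurable_snd.comp measurable_snd)
    have h2 : Measurable fun e : X × (A → I) × A => (f e.1 e.2.2 : ℝ) :=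
      measurable_apply_action (hf.comp measurable_fst) (measurable_snd.comp measurable_snd)
    have h3 : Measurable fun e : X × (A → I) × A => (e.2.1 e.2.2 : ℝ) :=
      measurable_apply_action (measurable_fst.comp measurable_snd)
        (measurable_snd.comp measurable_snd)
    have h4 := H.measurable_mean hDm n
    exact (((((h1.sub h3).pow_const 2).sub ((h2.sub h3).pow_const 2)).const_mul _).comp
      measurable_snd).sub ((h4.const_mul _).comp measurable_fst)

/-- The regret concentrates around the sum of its conditional means. -/
theorem IsAdaptiveRun.measure_regret_gt_le [DiscreteMeasurableSpace A] [IsProbabilityMeasure μ]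
    [IsProbabilityMeasure D] (H : IsAdaptiveRun μ D P T x r a) (hreal : Realizes D fstar)
    (hfs : Measurable fstar) {π : X → A} (hπ : Measurable π) {ε : ℝ} (hε : 0 < ε)
    {l : ℝ} (hl0 : 0 < l) (hl : l ≤ 1 / 2) :
    μ {ω | ∑ i ∈ range T, meanRegret (D.map Prod.fst) fstar π (P i (history x r a i ω))
        + 4 * l * T + Real.log (1 / ε) / l < regret π x r a T ω}
      ≤ ENNReal.ofReal ε := by
  refine (measure_mono fun ω hω => ?_).trans (H.measure_lt_sum_le
    (G := fun n h e => l * ((e.2.1 (π e.1) - e.2.1 e.2.2 : ℝ)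
      - meanRegret (D.map Prod.fst) fstar π (P n h)) - 4 * l ^ 2) (fun n => ?_)
    (fun n h => hreal.lintegral_exp_regret_le_one hfs hπ (H.policy n h) hl0.le hl) le_rfl hε)
  · have hω' : ∑ i ∈ range T, meanRegret (D.map Prod.fst) fstar π (P i (history x r a i ω))
        + 4 * l * T + Real.log (1 / ε) / l < regret π x r a T ω := hω
    show Real.log (1 / ε) < _
    rw [regret_eq_sum_range, ← sub_pos] at hω'
    have hpos := mul_pos hl0 hω'
    have hd : l * (Real.log (1 / ε) / l) = Real.log (1 / ε) := mul_div_cancel₀ _ hl0.ne'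
    simp only [sum_sub_distrib, ← mul_sum, sum_const, card_range, nsmul_eq_mul] at hpos ⊢
    rw [← sub_pos]
    refine hpos.trans_eq ?_
    linear_combination -hd
  · have h2 : Measurable fun e : X × (A → I) × A => (e.2.1 (π e.1) : ℝ) :=
      measurable_apply_action (measurable_fst.comp measurable_snd) (hπ.comp measurable_fst)
    have h3 : Measurable fun e : X × (A → I) × A => (e.2.1 e.2.2 : ℝ) :=
      measurable_apply_action (measurable_fst.comp measurable_snd)
        (measurable_snd.comp measurable_snd)
    have h4 := H.measurable_mean (u := fun x b => (fstar x (π x) : ℝ) - fstar x b)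
      (fun b => (measurable_apply_action hfs hπ).sub (measurable_coe_apply hfs b)) n
    exact ((((h2.sub h3).comp measurable_snd).sub (h4.comp measurable_fst)).const_mul _).sub_const _

end Concentration

/-! ### Inverse gap weighting -/

section InverseGap

variable {X A : Type*} [Fintype A] [DecidableEq A] {f : X → A → I} {γ : ℝ} {x : X} {b : A}

theorem card_le_inverseGapWeight {X A : Type*} [Fintype A] {f : X → A → I} {γ : ℝ} {x : X} {b : A}
    (hγ : 0 ≤ γ) (hb : ∀ c, f x c ≤ f x b) (c : A) :
    (Fintype.card A : ℝ) ≤ (Fintype.card A : ℝ) + γ * ((f x b : ℝ) - f x c) :=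
  le_add_of_nonneg_right <| mul_nonneg hγ <| sub_nonneg.2 <| hb c

/-- Away from the greedy action this is an equality. The other actions have probability at most 1/K
each, which leaves at least 1/K for the greedy one, whose gap is zero. -/
theorem one_le_actionProb_mul (hγ : 0 ≤ γ) (hb : ∀ c, f x c ≤ f x b) (c : A) :
    1 ≤ actionProb γ f x b c * ((Fintype.card A : ℝ) + γ * ((f x b : ℝ) - f x c)) := by
  have hK : (0 : ℝ) < Fintype.card A := by exact_mod_cast Fintype.card_pos_iff.2 ⟨b⟩
  have hW := card_le_inverseGapWeight hγ hb
  rw [actionProb]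
  split_ifs with h
  · subst h
    have h1 : ∑ d ∈ univ.erase c, 1 / ((Fintype.card A : ℝ) + γ * ((f x c : ℝ) - f x d))
        ≤ ∑ d ∈ univ.erase c, 1 / (Fintype.card A : ℝ) :=
      sum_le_sum fun d _ => one_div_le_one_div_of_le hK (hW d)
    have h2 : ∑ d ∈ univ.erase c, 1 / (Fintype.card A : ℝ) = 1 - 1 / (Fintype.card A : ℝ) := by
      have h3 := add_sum_erase univ (fun _ => 1 / (Fintype.card A : ℝ)) (mem_univ c)
      have h4 : ∑ _d : A, 1 / (Fintype.card A : ℝ) = 1 := by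
        simp [hK.ne']
      linarith
    rw [sub_self, mul_zero, add_zero]
    calc (1 : ℝ) = 1 / (Fintype.card A : ℝ) * Fintype.card A := by field_simp
      _ ≤ _ := by
        gcongr
        linarith
  · rw [one_div_mul_cancel (hK.trans_le (hW c)).ne']

theorem sum_actionProb (γ : ℝ) (f : X → A → I) (x : X) (b : A) :
    ∑ c, actionProb γ f x b c = 1 := by
  rw [← add_sum_erase univ _ (mem_univ b)]
  have : ∑ c ∈ univ.erase b, actionProb γ f x b c
      = ∑ c ∈ univ.erase b, 1 / ((Fintype.card A : ℝ) + γ * ((f x b : ℝ) - f x c)) :=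
    sum_congr rfl fun c hc => if_neg (ne_of_mem_erase hc)
  rw [this, actionProb, if_pos rfl, sub_add_cancel]

theorem actionProb_nonneg (hγ : 0 ≤ γ) (hb : ∀ c, f x c ≤ f x b) (c : A) :
    0 ≤ actionProb γ f x b c := by
  have hK : (0 : ℝ) < Fintype.card A := by exact_mod_cast Fintype.card_pos_iff.2 ⟨b⟩
  have hW := hK.trans_le (card_le_inverseGapWeight hγ hb c)
  exact (pos_of_mul_pos_left (one_pos.trans_le (one_le_actionProb_mul hγ hb c)) hW.le).le

/-- Each action contributes at most gap/(K + γ·gap) ≤ 1/γ, and the greedy one contributes nothing.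
-/
theorem sum_actionProb_mul_gap_le (hγ : 0 < γ) (hb : ∀ c, f x c ≤ f x b) :
    ∑ c, actionProb γ f x b c * ((f x b : ℝ) - f x c) ≤ (Fintype.card A : ℝ) / γ := by
  have hK : (0 : ℝ) < Fintype.card A := by exact_mod_cast Fintype.card_pos_iff.2 ⟨b⟩
  have h : ∀ c, actionProb γ f x b c * ((f x b : ℝ) - f x c) ≤ 1 / γ := fun c => by
    have hW := hK.trans_le (card_le_inverseGapWeight hγ.le hb c)
    rw [actionProb]
    split_ifs with hc
    · subst hc
      rw [sub_self, mul_zero]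
      positivity
    · rw [one_div_mul_eq_div, div_le_div_iff₀ hW hγ]
      linarith
  calc _ ≤ ∑ _c : A, 1 / γ := sum_le_sum fun c _ => h c
    _ = _ := by rw [sum_const, card_univ, nsmul_eq_mul, mul_one_div]

/-- Inverse gap weighting with the learning rate `γ`, the predictor `f` and greedy actions `π`. -/
def inverseGapPolicy (γ : ℝ) (f : X → A → I) (π : X → A) : X → A → ℝ :=
  fun x c => actionProb γ f x (π x) c

theorem measurable_actionProb [MeasurableSpace A] [DiscreteMeasurableSpace A]
    [MeasurableSpace X] (hf : Measurable f) {π : X → A} (hπ : Measurable π) (γ : ℝ) (c : A) :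
    Measurable fun x => actionProb γ f x (π x) c := by
  have h : Measurable fun y : A × X => actionProb γ f y.2 y.1 c :=
    measurable_from_prod_countable_right fun b => by
      have hm := measurable_coe_apply hf
      have hW : ∀ d, Measurable fun x =>
          1 / ((Fintype.card A : ℝ) + γ * ((f x b : ℝ) - f x d)) := fun d =>
        ((((hm b).sub (hm d)).const_mul γ).const_add _).const_div 1
      unfold actionProb
      dsimp only
      split_ifs
      · exact (Finset.measurable_sum _ fun d _ => hW d).const_sub 1
      · exact hW c
  exact h.comp (hπ.prodMk measurable_id)

theorem isStochasticPolicy_inverseGapPolicy [MeasurableSpace A] [DiscreteMeasurableSpace A]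
    [MeasurableSpace X] (hf : Measurable f) {π : X → A} (hπ : IsGreedyPolicy f π) (hγ : 0 ≤ γ) :
    IsStochasticPolicy (inverseGapPolicy γ f π) :=
  ⟨fun x c => actionProb_nonneg hγ (hπ.le x) c, fun x => sum_actionProb γ f x (π x),
    fun c => measurable_actionProb hf hπ.measurable γ c⟩

end InverseGap

/-! ### True regret against predicted regret -/

section Comparison

variable {X A : Type*} [MeasurableSpace X] [Fintype A]
  [MeasurableSpace A] [DiscreteMeasurableSpace A] {ν : Measure X}
  {f g h : X → A → I} {π ρ : X → A} {q : X → A → ℝ} {γ : ℝ}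

/-- The mean absolute difference of two predictors. -/
def absErr {X A : Type*} [MeasurableSpace X] [Fintype A] (ν : Measure X) (f g : X → A → I)
    (q : X → A → ℝ) : ℝ :=
  mean ν q fun x b => |(f x b : ℝ) - g x b|

theorem measurable_gap (hf : Measurable f) (hπ : Measurable π) (b : A) :
    Measurable fun x => (f x (π x) : ℝ) - f x b :=
  (measurable_apply_action hf hπ).sub (measurable_coe_apply hf b)

theorem absErr_comm {X A : Type*} [MeasurableSpace X] [Fintype A] (ν : Measure X)
    (f g : X → A → I) (q : X → A → ℝ) : absErr ν f g q = absErr ν g f q := by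
  simp only [absErr, abs_sub_comm]

/-- The deterministic policy `π`. -/
def pointPolicy {X A : Type*} [DecidableEq A] (π : X → A) : X → A → ℝ :=
  fun x b => if π x = b then 1 else 0

theorem isStochasticPolicy_pointPolicy [DecidableEq A] (hπ : Measurable π) :
    IsStochasticPolicy (pointPolicy π) := by
  refine ⟨fun x b => ?_, fun x => ?_, fun b => ?_⟩
  · unfold pointPolicy
    split_ifs <;> norm_num
  · simp [pointPolicy]
  · exact Measurable.ite (hπ (measurableSet_singleton b)) measurable_const measurable_const

theorem meanRegret_pointPolicy {X A : Type*} [MeasurableSpace X] [Fintype A] [DecidableEq A]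
    (ν : Measure X) (f : X → A → I) (π : X → A) :
    meanRegret ν f π (pointPolicy π) = 0 := by
  simp [meanRegret, mean, pointPolicy]

theorem meanRegret_nonneg {X A : Type*} [MeasurableSpace X] [Fintype A] [MeasurableSpace A]
    {ν : Measure X} {f : X → A → I} {π : X → A} {q : X → A → ℝ} (hπ : IsGreedyPolicy f π) (hq : IsStochasticPolicy q) :
    0 ≤ meanRegret ν f π q :=
  integral_nonneg fun x => sum_nonneg fun b _ =>
    mul_nonneg (hq.nonneg x b) (sub_nonneg.2 (hπ.le x b))

theorem meanRegret_le_one [IsProbabilityMeasure ν] (hf : Measurable f) (hπ : Measurable π)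
    (hq : IsStochasticPolicy q) : meanRegret ν f π q ≤ 1 :=
  (le_abs_self _).trans
    (hq.abs_mean_le (measurable_gap hf hπ) fun _ _ => abs_sub_le_one _ _)

theorem meanRegret_inverseGapPolicy_le [DecidableEq A] [IsProbabilityMeasure ν] (hf : Measurable f)
    (hπ : IsGreedyPolicy f π) (hγ : 0 < γ) :
    meanRegret ν f π (inverseGapPolicy γ f π) ≤ (Fintype.card A : ℝ) / γ := by
  have hq := isStochasticPolicy_inverseGapPolicy hf hπ hγ.le
  calc meanRegret ν f π (inverseGapPolicy γ f π) ≤ ∫ _x, (Fintype.card A : ℝ) / γ ∂ν :=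
        integral_mono (hq.integrable (C := 1) (measurable_gap hf hπ.measurable)
          fun _ _ => abs_sub_le_one _ _) (integrable_const _)
          fun x => sum_actionProb_mul_gap_le hγ (hπ.le x)
    _ = _ := by simp

/-- Replacing g(ρ) by the smaller g(π) leaves only differences of f and g at the actions π and b.
Greediness is needed for ρ alone, so the lemma can be used with the true and the predicted reward in
either role. -/
theorem meanRegret_sub_le [DecidableEq A] [IsProbabilityMeasure ν] (hf : Measurable f) (hg : Measurable g)
    (hπ : Measurable π) (hρ : IsGreedyPolicy g ρ) (hq : IsStochasticPolicy q) :
    meanRegret ν f π q - meanRegret ν g ρ q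
      ≤ absErr ν f g (pointPolicy π) + absErr ν f g q := by
  have hπp := isStochasticPolicy_pointPolicy hπ
  have hmf : ∀ b, Measurable fun x => |(f x b : ℝ) - g x b| := fun b =>
    ((measurable_coe_apply hf b).sub (measurable_coe_apply hg b)).abs
  have hb : ∀ x b, |(|(f x b : ℝ) - g x b|)| ≤ 1 := fun x b => by
    rw [abs_abs]
    exact abs_sub_le_one _ _
  have i1 := hq.integrable (ν := ν) (C := 1) (measurable_gap hf hπ) fun _ _ => abs_sub_le_one _ _
  have i2 := hq.integrable (ν := ν) (C := 1) (measurable_gap hg hρ.measurable)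
    fun _ _ => abs_sub_le_one _ _
  unfold meanRegret absErr mean
  rw [← integral_sub i1 i2, ← integral_add (hπp.integrable hmf hb) (hq.integrable hmf hb)]
  refine integral_mono (i1.sub i2) ((hπp.integrable hmf hb).add (hq.integrable hmf hb))
    fun x => ?_
  have h1 : ∑ b, pointPolicy π x b * |(f x b : ℝ) - g x b| = |(f x (π x) : ℝ) - g x (π x)| := by
    simp [pointPolicy]
  show ∑ b, q x b * ((f x (π x) : ℝ) - f x b) - ∑ b, q x b * ((g x (ρ x) : ℝ) - g x b)
    ≤ ∑ b, pointPolicy π x b * |(f x b : ℝ) - g x b| + ∑ b, q x b * |(f x b : ℝ) - g x b|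
  rw [h1, ← one_mul |(f x (π x) : ℝ) - g x (π x)|, ← hq.sum_eq_one x, sum_mul,
    ← sum_sub_distrib, ← sum_add_distrib]
  refine sum_le_sum fun b _ => ?_
  have h2 : (g x (π x) : ℝ) ≤ g x (ρ x) := hρ.le x (π x)
  have h3 := le_abs_self ((f x (π x) : ℝ) - g x (π x))
  have h4 := neg_abs_le ((f x b : ℝ) - g x b)
  rw [← mul_sub, ← mul_add]
  exact mul_le_mul_of_nonneg_left (by linarith) (hq.nonneg x b)

/-- From pW ≥ 1, W times p(2sd)² + W - 4sd is at least (2sd - W)² ≥ 0; this is the AM-GM inequality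
with W in place of 1/p. Multiplying by q, the factor q in front of the square is dropped because q ≤
1. -/
theorem mul_le_weighted_sq {p W q d s : ℝ} (hpW : 1 ≤ p * W) (hW : 0 < W) (hp : 0 ≤ p)
    (hq : 0 ≤ q) (hq1 : q ≤ 1) (hs : 0 < s) :
    q * d ≤ s * (p * d ^ 2) + 1 / (4 * s) * (q * W) := by
  have h1 : 0 ≤ p * (2 * s * d) ^ 2 + W - 4 * s * d := by
    refine (mul_nonneg_iff_of_pos_right hW).1 ?_
    nlinarith [mul_le_mul_of_nonneg_right hpW (sq_nonneg (2 * s * d)), sq_nonneg (2 * s * d - W)]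
  have h2 : 0 ≤ (1 - q) * (p * (2 * s * d) ^ 2) := by
    have := sub_nonneg.2 hq1
    positivity
  have h3 : s * (p * d ^ 2) + 1 / (4 * s) * (q * W) - q * d
      = 1 / (4 * s) * (q * (p * (2 * s * d) ^ 2 + W - 4 * s * d)
        + (1 - q) * (p * (2 * s * d) ^ 2)) := by
    field_simp
    ring
  rw [← sub_nonneg, h3]
  positivity

/-- A change of measure from an inverse gap weighting policy to an arbitrary policy `q`. -/
theorem absErr_le [DecidableEq A] [IsProbabilityMeasure ν] (hf : Measurable f) (hg : Measurable g)
    (hh : Measurable h) (hρ : IsGreedyPolicy h ρ) (hγ : 0 ≤ γ) (hq : IsStochasticPolicy q)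
    {s : ℝ} (hs : 0 < s) :
    absErr ν f g q ≤ s * sqErr ν f g (inverseGapPolicy γ h ρ)
      + 1 / (4 * s) * (Fintype.card A + γ * meanRegret ν h ρ q) := by
  have hp := isStochasticPolicy_inverseGapPolicy hh hρ hγ
  have i1 := hq.integrable (ν := ν) (u := fun x b => |(f x b : ℝ) - g x b|) (C := 1)
    (fun b => ((measurable_coe_apply hf b).sub (measurable_coe_apply hg b)).abs) fun x b => by
      rw [abs_abs]
      exact abs_sub_le_one _ _
  have i2 := hp.integrable (ν := ν) (u := fun x b => ((f x b : ℝ) - g x b) ^ 2) (C := 1)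
    (fun b => ((measurable_coe_apply hf b).sub (measurable_coe_apply hg b)).pow_const 2)
    fun x b => abs_sq_sub_le_one _ _
  have i3 := hq.integrable (ν := ν) (C := 1) (measurable_gap hh hρ.measurable)
    fun _ _ => abs_sub_le_one _ _
  have i3' : Integrable (fun x => (Fintype.card A : ℝ)
      + γ * ∑ b, q x b * ((h x (ρ x) : ℝ) - h x b)) ν := (integrable_const _).add (i3.const_mul γ)
  have i4 := (i2.const_mul s).add (i3'.const_mul (1 / (4 * s)))
  have e : ∫ x, (s * ∑ b, inverseGapPolicy γ h ρ x b * ((f x b : ℝ) - g x b) ^ 2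
      + 1 / (4 * s) * (Fintype.card A + γ * ∑ b, q x b * ((h x (ρ x) : ℝ) - h x b))) ∂ν
      = s * sqErr ν f g (inverseGapPolicy γ h ρ)
      + 1 / (4 * s) * (Fintype.card A + γ * meanRegret ν h ρ q) := by
    rw [integral_add (i2.const_mul s) (i3'.const_mul _), integral_const_mul,
      integral_const_mul, integral_add (integrable_const _) (i3.const_mul γ), integral_const_mul]
    simp [sqErr, meanRegret, mean]
  rw [← e]
  refine integral_mono i1 i4 fun x => ?_
  have hsum : s * ∑ b, inverseGapPolicy γ h ρ x b * ((f x b : ℝ) - g x b) ^ 2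
      + 1 / (4 * s) * (Fintype.card A + γ * ∑ b, q x b * ((h x (ρ x) : ℝ) - h x b))
      = ∑ b, (s * (inverseGapPolicy γ h ρ x b * ((f x b : ℝ) - g x b) ^ 2)
        + 1 / (4 * s) * (q x b * (Fintype.card A + γ * ((h x (ρ x) : ℝ) - h x b)))) := by
    rw [sum_add_distrib, ← mul_sum, ← mul_sum]
    simp only [mul_add, sum_add_distrib, ← sum_mul, hq.sum_eq_one, one_mul, mul_sum]
    simp only [mul_left_comm γ]
  refine le_of_le_of_eq (sum_le_sum fun b _ => ?_) hsum.symm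
  have hK : (0 : ℝ) < Fintype.card A := by exact_mod_cast Fintype.card_pos_iff.2 ⟨b⟩
  rw [← sq_abs ((f x b : ℝ) - g x b)]
  exact mul_le_weighted_sq (one_le_actionProb_mul hγ (hρ.le x) b)
    (hK.trans_le (card_le_inverseGapWeight hγ (hρ.le x) b)) (hp.nonneg x b) (hq.nonneg x b)
    (hq.le_one x b) hs

/-- The epochs of inverse gap weighting: if the predictor of each epoch is accurate for the policies
of the rounds before that epoch, then it ranks all policies up to the scale `K / γ m`. -/
theorem meanRegret_comparison [DecidableEq A] [Nonempty A] [IsProbabilityMeasure ν]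
    {fstar : X → A → I} {πstar : X → A} {fhat : ℕ → X → A → I} {πhat : ℕ → X → A} {γ : ℕ → ℝ}
    {τ ep : ℕ → ℕ} (hfs : Measurable fstar) (hπs : IsGreedyPolicy fstar πstar)
    (hfh : ∀ m, Measurable (fhat m)) (hπh : ∀ m, IsGreedyPolicy (fhat m) (πhat m))
    (hγ1 : γ 1 = 1) (hγ : ∀ m, 2 ≤ m → 0 < γ m)
    (hmono : ∀ i m, 2 ≤ i → i ≤ m → γ i ≤ γ m) (hτ : ∀ m, 2 ≤ m → 1 ≤ τ (m - 1))
    (hep : ∀ m, 2 ≤ m → ∀ n < τ (m - 1), 1 ≤ ep n ∧ ep n < m)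
    (herr : ∀ m, 2 ≤ m → ∑ n ∈ range (τ (m - 1)), sqErr ν (fhat m) fstar
      (inverseGapPolicy (γ (ep n)) (fhat (ep n)) (πhat (ep n)))
        ≤ 8 / 225 * (Fintype.card A * τ (m - 1)) / γ m ^ 2)
    (m : ℕ) (hm : 2 ≤ m) : ∀ q, IsStochasticPolicy q →
      meanRegret ν fstar πstar q
        ≤ 2 * meanRegret ν (fhat m) (πhat m) q + Fintype.card A / γ m ∧
      meanRegret ν (fhat m) (πhat m) q
        ≤ 2 * meanRegret ν fstar πstar q + Fintype.card A / γ m := by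
  induction m using Nat.strong_induction_on with
  | _ m ih =>
  have hγm := hγ m hm
  have hτm : (0 : ℝ) < τ (m - 1) := by exact_mod_cast hτ m hm
  have hK : (1 : ℝ) ≤ Fintype.card A := by exact_mod_cast Fintype.card_pos
  have key : ∀ q, IsStochasticPolicy q → absErr ν (fhat m) fstar q
      ≤ 1 / 3 * (Fintype.card A / γ m) + 1 / 4 * meanRegret ν fstar πstar q := by
    intro q hq
    have hR : 0 ≤ meanRegret ν fstar πstar q := meanRegret_nonneg hπs hq
    have hV : ∀ n < τ (m - 1), Fintype.card A
        + γ (ep n) * meanRegret ν (fhat (ep n)) (πhat (ep n)) q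
        ≤ 2 * Fintype.card A + 2 * γ m * meanRegret ν fstar πstar q := by
      intro n hn
      obtain ⟨h1, h2⟩ := hep m hm n hn
      -- The first predictor carries no guarantee, but `γ 1 = 1` and a predicted regret is at most 1
      -- ≤ K. For later epochs the induction hypothesis is multiplied by `γ (ep n)`, which is then
      -- raised to `γ m` by monotonicity.
      rcases h1.eq_or_lt with h1 | h1
      · rw [← h1, hγ1]
        have := meanRegret_le_one (ν := ν) (hfh 1) (hπh 1).measurable hq
        have := mul_nonneg hγm.le hR
        linarith
      · have h3 := (ih (ep n) h2 h1 q hq).2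
        have hpos := hγ (ep n) h1
        have h4 := mul_le_mul_of_nonneg_left h3 hpos.le
        rw [mul_add, mul_div_cancel₀ _ hpos.ne'] at h4
        have h5 := mul_le_mul_of_nonneg_right (hmono (ep n) m h1 h2.le) hR
        linarith
    have hround : ∀ n ∈ range (τ (m - 1)), absErr ν (fhat m) fstar q
        ≤ 2 * γ m * sqErr ν (fhat m) fstar
            (inverseGapPolicy (γ (ep n)) (fhat (ep n)) (πhat (ep n)))
          + 1 / (4 * (2 * γ m)) * (2 * Fintype.card A + 2 * γ m * meanRegret ν fstar πstar q) := by
      intro n hn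
      have hn' := mem_range.1 hn
      obtain ⟨h1, -⟩ := hep m hm n hn'
      have hγn : 0 ≤ γ (ep n) := by
        rcases h1.eq_or_lt with h1 | h1
        · rw [← h1, hγ1]; norm_num
        · exact (hγ _ h1).le
      -- The choice s = 2γ_m makes the coefficient of R(q) equal to 1/4. Averaged over the past
      -- rounds, the squared errors add 16/225 · K/γ_m to the K/(4γ_m) of the weights, in total less
      -- than K/(3γ_m).
      refine (absErr_le (hfh m) hfs (hfh (ep n)) (hπh (ep n)) hγn hq
        (by positivity : 0 < 2 * γ m)).trans ?_
      exact add_le_add_right (mul_le_mul_of_nonneg_left (hV n hn') (by positivity)) _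
    have hsum := sum_le_sum hround
    rw [sum_const, card_range, nsmul_eq_mul, sum_add_distrib, ← mul_sum, sum_const, card_range,
      nsmul_eq_mul] at hsum
    have h1 := mul_le_mul_of_nonneg_left (herr m hm) (by positivity : 0 ≤ 2 * γ m)
    have h2 : 2 * γ m * (8 / 225 * (Fintype.card A * τ (m - 1)) / γ m ^ 2)
        = τ (m - 1) * (16 / 225 * (Fintype.card A / γ m)) := by
      field_simp
      norm_num
    have h3 : 1 / (4 * (2 * γ m)) * (2 * Fintype.card A + 2 * γ m * meanRegret ν fstar πstar q)
        = 1 / 4 * (Fintype.card A / γ m) + 1 / 4 * meanRegret ν fstar πstar q := by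
      field_simp
    rw [h3] at hsum
    rw [h2] at h1
    have h4 : absErr ν (fhat m) fstar q ≤ 16 / 225 * (Fintype.card A / γ m)
        + (1 / 4 * (Fintype.card A / γ m) + 1 / 4 * meanRegret ν fstar πstar q) := by
      refine le_of_mul_le_mul_left ?_ hτm
      rw [mul_add]
      linarith
    have h5 : 0 ≤ Fintype.card A / γ m := by positivity
    linarith
  have hfirst : ∀ q, IsStochasticPolicy q → meanRegret ν fstar πstar q
      ≤ 4 / 3 * meanRegret ν (fhat m) (πhat m) q + 8 / 9 * (Fintype.card A / γ m) := by
    intro q hq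
    have h1 := meanRegret_sub_le (ν := ν) hfs (hfh m) hπs.measurable (hπh m) hq
    rw [absErr_comm, absErr_comm _ _ _ q] at h1
    have h2 := key q hq
    -- The optimal policy has true regret zero, so only K/(3γ_m) remains there. Solving (3/4)R ≤ R_m
    -- + (2/3)K/γ_m gives the constants 4/3 and 8/9.
    have h3 := key _ (isStochasticPolicy_pointPolicy hπs.measurable)
    rw [meanRegret_pointPolicy] at h3
    linarith
  intro q hq
  have hnn : 0 ≤ meanRegret ν (fhat m) (πhat m) q := meanRegret_nonneg (hπh m) hq
  have hnn' : 0 ≤ meanRegret ν fstar πstar q := meanRegret_nonneg hπs hq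
  have h0 : 0 ≤ Fintype.card A / γ m := by positivity
  refine ⟨?_, ?_⟩
  · linarith [hfirst q hq]
  · have h1 := meanRegret_sub_le (ν := ν) (hfh m) hfs (hπh m).measurable hπs hq
    have hp := isStochasticPolicy_pointPolicy (hπh m).measurable
    -- The greedy policy of the predictor has predicted regret zero, hence true regret at most
    -- (8/9)K/γ_m by the first comparison. This is why the two directions are proved in this order.
    have h2 := hfirst _ hp
    rw [meanRegret_pointPolicy] at h2
    linarith [key q hq, key _ hp]

end Comparison

/-! ### Epoch schedules and the sum over rounds -/

section Schedule

variable {T : ℕ}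

/-- Additive constants are absorbed into log log T through this bound. It comes from log y ≥ 1 -
1/y, used at y = 3/e to get log 3 ≥ 1.09, then at y = 1.09. -/
theorem log_log_lower_bound (hT : 3 ≤ T) : 2 / 25 ≤ Real.log (Real.log T) := by
  have h3 : (3 : ℝ) ≤ T := by exact_mod_cast hT
  have he := Real.exp_one_lt_d9
  have h1 : 1 - (3 / Real.exp 1)⁻¹ ≤ Real.log (3 / Real.exp 1) :=
    Real.one_sub_inv_le_log_of_pos (by positivity)
  rw [Real.log_div (by norm_num) (Real.exp_ne_zero 1), Real.log_exp, inv_div] at h1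
  have h2 : 109 / 100 ≤ Real.log 3 := by linarith
  have h4 : 109 / 100 ≤ Real.log T := h2.trans (Real.log_le_log (by norm_num) h3)
  have h5 := Real.one_sub_inv_le_log_of_pos (by norm_num : (0 : ℝ) < 109 / 100)
  have h6 := Real.log_le_log (by norm_num : (0 : ℝ) < 109 / 100) h4
  norm_num at h5
  linarith

theorem one_lt_logb_two (hT : 3 ≤ T) : 1 < Real.logb 2 T := by
  rw [Real.lt_logb_iff_rpow_lt (by norm_num) (by positivity), Real.rpow_one]
  exact_mod_cast hT

theorem one_le_lastEpoch (hT : 3 ≤ T) : 1 ≤ lastEpoch T :=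
  Nat.one_le_iff_ne_zero.2 (Nat.ceil_pos.2 (Real.logb_pos (by norm_num) (one_lt_logb_two hT))).ne'

/-- Changing the base and rounding up give at most (3/2) log log T + 7/4; the constant 7/4 is
absorbed because log log T ≥ 2/25. -/
theorem lastEpoch_le (hT : 3 ≤ T) : (lastEpoch T : ℝ) ≤ 25 * Real.log (Real.log T) := by
  have h0 := Real.logb_pos (by norm_num : (1 : ℝ) < 2) (one_lt_logb_two hT)
  have h1 := Nat.ceil_lt_add_one h0.le
  have h2 := log_log_lower_bound hT
  have hl2 := Real.log_two_gt_d9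
  have hlT : 0 < Real.log T := Real.log_pos (by exact_mod_cast (by omega : 1 < T))
  have h3 := Real.one_sub_inv_le_log_of_pos (by linarith : 0 < Real.log 2)
  have h4 : (Real.log 2)⁻¹ ≤ 3 / 2 := by
    rw [inv_le_comm₀ (by linarith) (by norm_num)]
    linarith
  have h5 : Real.logb 2 (Real.logb 2 T)
      = (Real.log (Real.log T) - Real.log (Real.log 2)) * (Real.log 2)⁻¹ := by
    rw [Real.logb, Real.logb, Real.log_div hlT.ne' (by linarith), div_eq_mul_inv]
  have h6 : Real.logb 2 (Real.logb 2 T) ≤ (Real.log (Real.log T) + 1 / 2) * (3 / 2) := by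
    rw [h5]
    exact mul_le_mul (by linarith) h4 (inv_nonneg.2 (by linarith)) (by linarith)
  unfold lastEpoch
  linarith

theorem schedule_zero (T : ℕ) : schedule T 0 = 0 := if_pos rfl

theorem schedule_of_pos {m : ℕ} (hm : 1 ≤ m) :
    schedule T m = ⌈(T : ℝ) ^ (1 - (1 / 2 : ℝ) ^ m)⌉₊ := if_neg (by omega)

theorem schedule_mono (hT : 1 ≤ T) : Monotone (schedule T) := by
  refine monotone_nat_of_le_succ fun m => ?_
  rcases Nat.eq_zero_or_pos m with rfl | hm
  · simp [schedule_zero]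
  · rw [schedule_of_pos hm, schedule_of_pos (Nat.le_add_left 1 m)]
    refine Nat.ceil_mono (Real.rpow_le_rpow_of_exponent_le (by exact_mod_cast hT) ?_)
    have : (1 / 2 : ℝ) ^ (m + 1) ≤ (1 / 2) ^ m :=
      pow_le_pow_of_le_one (by norm_num) (by norm_num) (Nat.le_succ m)
    linarith

theorem schedule_le (hT : 1 ≤ T) (m : ℕ) : schedule T m ≤ T := by
  rcases Nat.eq_zero_or_pos m with rfl | hm
  · simp [schedule_zero]
  · rw [schedule_of_pos hm, Nat.ceil_le]
    have h := Real.rpow_le_rpow_of_exponent_le (by exact_mod_cast hT : (1 : ℝ) ≤ T)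
      (by linarith [pow_pos (by norm_num : (0 : ℝ) < 1 / 2) m] : 1 - (1 / 2 : ℝ) ^ m ≤ 1)
    rwa [Real.rpow_one] at h

/-- The real power tends to T; once it exceeds T - 1, rounding up reaches T. -/
theorem exists_le_schedule (hT : 1 ≤ T) : ∃ m, 1 ≤ m ∧ T ≤ schedule T m := by
  have hT0 : (0 : ℝ) < T := by exact_mod_cast hT
  have h1 : Filter.Tendsto (fun m : ℕ => (T : ℝ) ^ (1 - (1 / 2 : ℝ) ^ m)) Filter.atTop
      (nhds ((T : ℝ) ^ (1 - 0 : ℝ))) :=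
    ((Real.continuous_const_rpow hT0.ne').tendsto _).comp
      ((tendsto_pow_atTop_nhds_zero_of_lt_one (r := (1 / 2 : ℝ)) (by norm_num)
        (by norm_num)).const_sub 1)
  rw [sub_zero, Real.rpow_one] at h1
  obtain ⟨m, hm, hm1⟩ := ((h1.eventually (lt_mem_nhds (by linarith : (T : ℝ) - 1 < T))).and
    (Filter.eventually_ge_atTop 1)).exists
  refine ⟨m, hm1, ?_⟩
  rw [schedule_of_pos hm1]
  have : T - 1 < ⌈(T : ℝ) ^ (1 - (1 / 2 : ℝ) ^ m)⌉₊ := by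
    rw [Nat.lt_ceil, Nat.cast_sub hT]
    exact_mod_cast hm
  omega

/-- The exponents satisfy 2(1 - 2^{-(m+1)}) = 1 + (1 - 2^{-m}): before rounding, each epoch end is
the geometric mean of T and the previous one. -/
theorem sq_rpow_schedule (hT : 1 ≤ T) (m : ℕ) :
    ((T : ℝ) ^ (1 - (1 / 2 : ℝ) ^ (m + 1))) ^ 2 = T * (T : ℝ) ^ (1 - (1 / 2 : ℝ) ^ m) := by
  have hT0 : (0 : ℝ) < T := by exact_mod_cast hT
  rw [← Real.rpow_natCast, ← Real.rpow_mul hT0.le]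
  nth_rewrite 2 [← Real.rpow_one (T : ℝ)]
  rw [← Real.rpow_add hT0]
  congr 1
  push_cast
  ring

/-- For m ≥ log₂ log₂ T one has log₂ T ≤ 2^m, that is, T^{2^{-m}} ≤ 2. -/
theorem half_le_rpow_lastEpoch (hT : 3 ≤ T) {m : ℕ} (hm : lastEpoch T ≤ m) :
    (T : ℝ) / 2 ≤ (T : ℝ) ^ (1 - (1 / 2 : ℝ) ^ m) := by
  have hT0 : (0 : ℝ) < T := by positivity
  have h1 : Real.logb 2 (Real.logb 2 T) ≤ m := (Nat.le_ceil _).trans (by exact_mod_cast hm)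
  rw [Real.logb_le_iff_le_rpow (by norm_num) (by linarith [one_lt_logb_two hT]),
    Real.logb_le_iff_le_rpow (by norm_num) hT0] at h1
  have h2 : (T : ℝ) ^ ((1 / 2 : ℝ) ^ m) ≤ 2 := by
    refine (Real.rpow_le_rpow hT0.le h1 (by positivity)).trans_eq ?_
    rw [← Real.rpow_mul (by norm_num), Real.rpow_natCast, ← mul_pow]
    norm_num
  rw [Real.rpow_sub hT0, Real.rpow_one]
  exact div_le_div_of_nonneg_left hT0.le (by positivity) h2

/-- The properties of the epoch schedules on which the regret bound depends. -/
structure IsGoodSchedule (T : ℕ) (τ : ℕ → ℕ) : Prop where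
  zero : τ 0 = 0
  one_le : ∀ m, 1 ≤ m → 1 ≤ τ m
  mono : Monotone τ
  le : ∀ m, τ m ≤ T
  exists_le : ∃ m, 1 ≤ m ∧ T ≤ τ m
  first_le : (τ 1 : ℝ) ≤ 2 * √T
  sub_le : ∀ m, 1 ≤ m → m < lastEpoch T → (τ (m + 1) : ℝ) - τ m ≤ 2 * (√T * √(τ m))
  half_le : ∀ m, lastEpoch T ≤ m → (T : ℝ) / 2 ≤ τ m

theorem rpow_one_sub_half (T : ℕ) : (T : ℝ) ^ (1 - (1 / 2 : ℝ) ^ 1) = √T := by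
  rw [Real.sqrt_eq_rpow]
  norm_num

theorem schedule_one_le (hT : 1 ≤ T) : (schedule T 1 : ℝ) ≤ 2 * √T := by
  rw [schedule_of_pos le_rfl, rpow_one_sub_half]
  have h1 := Nat.ceil_lt_add_one (Real.sqrt_nonneg (T : ℝ))
  have h2 : 1 ≤ √(T : ℝ) := Real.one_le_sqrt.2 (by exact_mod_cast hT)
  linarith

theorem one_le_schedule (hT : 1 ≤ T) {m : ℕ} (hm : 1 ≤ m) : 1 ≤ schedule T m := by
  rw [schedule_of_pos hm, Nat.one_le_ceil_iff]
  exact Real.rpow_pos_of_pos (by exact_mod_cast hT) _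

theorem rpow_le_schedule {m : ℕ} (hm : 1 ≤ m) :
    (T : ℝ) ^ (1 - (1 / 2 : ℝ) ^ m) ≤ schedule T m := by
  rw [schedule_of_pos hm]
  exact Nat.le_ceil _

theorem rpow_le_sqrt_mul_sqrt_schedule (hT : 1 ≤ T) {m : ℕ} (hm : 1 ≤ m) :
    (T : ℝ) ^ (1 - (1 / 2 : ℝ) ^ (m + 1)) ≤ √T * √(schedule T m) := by
  rw [← Real.sqrt_mul (by positivity)]
  refine Real.le_sqrt_of_sq_le ?_
  rw [sq_rpow_schedule hT]
  gcongr
  exact rpow_le_schedule hm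

theorem schedule_succ_sub_le (hT : 1 ≤ T) {m : ℕ} (hm : 1 ≤ m) :
    (schedule T (m + 1) : ℝ) - schedule T m ≤ 2 * (√T * √(schedule T m)) := by
  have h1 : (1 : ℝ) ≤ schedule T m := by exact_mod_cast one_le_schedule hT hm
  have h2 := rpow_le_sqrt_mul_sqrt_schedule hT hm
  have h3 := Nat.ceil_lt_add_one (Real.rpow_nonneg T.cast_nonneg (1 - (1 / 2 : ℝ) ^ (m + 1)))
  rw [← schedule_of_pos (Nat.le_add_left 1 m)] at h3
  have h4 : 0 ≤ √T * √(schedule T m) := by positivity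
  linarith

theorem isGoodSchedule_schedule (hT : 3 ≤ T) : IsGoodSchedule T (schedule T) where
  zero := schedule_zero T
  one_le _ := one_le_schedule (by omega)
  mono := schedule_mono (by omega)
  le := schedule_le (by omega)
  exists_le := exists_le_schedule (by omega)
  first_le := schedule_one_le (by omega)
  sub_le _ hm _ := schedule_succ_sub_le (by omega) hm
  half_le _ hm := (half_le_rpow_lastEpoch hT hm).trans
    (rpow_le_schedule ((one_le_lastEpoch hT).trans hm))

theorem closedSchedule_of_lt {m : ℕ} (hm : m < lastEpoch T) :
    closedSchedule T m = schedule T m := if_pos hm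

theorem closedSchedule_of_ge {m : ℕ} (hm : lastEpoch T ≤ m) : closedSchedule T m = T :=
  if_neg (by omega)

theorem isGoodSchedule_closedSchedule (hT : 3 ≤ T) : IsGoodSchedule T (closedSchedule T) where
  zero := by rw [closedSchedule_of_lt (one_le_lastEpoch hT), schedule_zero]
  one_le m hm := by
    rcases lt_or_ge m (lastEpoch T) with h | h
    · rw [closedSchedule_of_lt h]
      exact one_le_schedule (by omega) hm
    · rw [closedSchedule_of_ge h]
      omega
  mono := by
    intro i j hij
    rcases lt_or_ge j (lastEpoch T) with h | h
    · rw [closedSchedule_of_lt h, closedSchedule_of_lt (hij.trans_lt h)]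
      exact schedule_mono (by omega) hij
    · rw [closedSchedule_of_ge h]
      rcases lt_or_ge i (lastEpoch T) with h' | h'
      · rw [closedSchedule_of_lt h']
        exact schedule_le (by omega) i
      · rw [closedSchedule_of_ge h']
  le m := by
    rcases lt_or_ge m (lastEpoch T) with h | h
    · rw [closedSchedule_of_lt h]
      exact schedule_le (by omega) m
    · rw [closedSchedule_of_ge h]
  exists_le := ⟨lastEpoch T, one_le_lastEpoch hT, (closedSchedule_of_ge le_rfl).ge⟩
  first_le := by
    rcases lt_or_ge 1 (lastEpoch T) with h | h
    · rw [closedSchedule_of_lt h]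
      exact schedule_one_le (by omega)
    · rw [closedSchedule_of_ge h]
      -- If the first epoch is already the last one, it has length T, but then T/2 ≤ √T.
      have h1 := half_le_rpow_lastEpoch hT h
      rw [rpow_one_sub_half] at h1
      linarith
  sub_le m hm hlt := by
    rw [closedSchedule_of_lt hlt]
    rcases lt_or_ge (m + 1) (lastEpoch T) with h | h
    · rw [closedSchedule_of_lt h]
      exact schedule_succ_sub_le (by omega) hm
    · rw [closedSchedule_of_ge h]
      -- Extending the last epoch to T at most doubles the unrounded epoch end, which is at most √T
      -- √τ_m.
      have h1 := half_le_rpow_lastEpoch hT h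
      have h2 := rpow_le_sqrt_mul_sqrt_schedule (by omega : 1 ≤ T) hm
      have h3 : (0 : ℝ) ≤ schedule T m := Nat.cast_nonneg _
      linarith
  half_le m hm := by
    rw [closedSchedule_of_ge hm]
    linarith [(Nat.cast_nonneg T : (0 : ℝ) ≤ T)]

theorem epochOf_le {τ : ℕ → ℕ} {m t : ℕ} (hm : 1 ≤ m) (ht : t ≤ τ m) : epochOf τ t ≤ m :=
  Nat.sInf_le ⟨hm, ht⟩

theorem IsGoodSchedule.epochOf_spec {τ : ℕ → ℕ} (h : IsGoodSchedule T τ) {t : ℕ} (ht : t ≤ T) :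
    1 ≤ epochOf τ t ∧ t ≤ τ (epochOf τ t) := by
  obtain ⟨m, hm, hTm⟩ := h.exists_le
  exact Nat.sInf_mem (s := {m : ℕ | 1 ≤ m ∧ t ≤ τ m}) ⟨m, hm, ht.trans hTm⟩

theorem IsGoodSchedule.lt_of_epochOf {τ : ℕ → ℕ} (h : IsGoodSchedule T τ) {t : ℕ} (ht : 1 ≤ t) :
    τ (epochOf τ t - 1) < t := by
  by_contra! hc
  rcases Nat.eq_zero_or_pos (epochOf τ t - 1) with h0 | h0
  · rw [h0, h.zero] at hc
    omega
  · have := epochOf_le h0 hc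
    omega

/-- Summing `B / √τ_{m(t)-1}` over all rounds `t`. -/
theorem IsGoodSchedule.sum_le {τ : ℕ → ℕ} (h : IsGoodSchedule T τ) {B : ℝ} (hB : 1 ≤ B)
    {v : ℕ → ℝ} (hv1 : ∀ n < T, v n ≤ 1)
    (hv : ∀ n < T, 2 ≤ epochOf τ (n + 1) → v n ≤ B / √(τ (epochOf τ (n + 1) - 1))) :
    ∑ n ∈ range T, v n ≤ (2 * lastEpoch T + 2) * (√T * B) := by
  have hsT : 0 ≤ √(T : ℝ) := Real.sqrt_nonneg _
  -- Up to epoch `lastEpoch T` each epoch is charged 2√T·B separately. The later rounds are charged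
  -- together, at 2B/√T each, since half of the horizon precedes their epoch.
  rw [← sum_filter_add_sum_filter_not (range T) (fun n => epochOf τ (n + 1) ≤ lastEpoch T),
    add_mul]
  refine add_le_add ?_ ?_
  · have hmaps : ∀ n ∈ (range T).filter (fun n => epochOf τ (n + 1) ≤ lastEpoch T),
        epochOf τ (n + 1) ∈ Icc 1 (lastEpoch T) := fun n hn => by
      rw [mem_filter, mem_range] at hn
      exact mem_Icc.2 ⟨(h.epochOf_spec (by omega)).1, hn.2⟩
    rw [← sum_fiberwise_of_maps_to hmaps]
    have hm : ∀ m ∈ Icc 1 (lastEpoch T), ∑ n ∈ ((range T).filter (fun n =>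
        epochOf τ (n + 1) ≤ lastEpoch T)).filter (fun n => epochOf τ (n + 1) = m), v n
        ≤ 2 * (√T * B) := by
      intro m hm
      rw [mem_Icc] at hm
      have hsub : ((range T).filter (fun n => epochOf τ (n + 1) ≤ lastEpoch T)).filter
          (fun n => epochOf τ (n + 1) = m) ⊆ Ico (τ (m - 1)) (τ m) := by
        intro n hn
        rw [mem_filter, mem_filter, mem_range] at hn
        obtain ⟨⟨hn1, -⟩, rfl⟩ := hn
        have h1 := (h.epochOf_spec (by omega : n + 1 ≤ T)).2
        have h2 := h.lt_of_epochOf (Nat.le_add_left 1 n)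
        exact mem_Ico.2 ⟨by omega, by omega⟩
      have hcard : (#(((range T).filter (fun n => epochOf τ (n + 1) ≤ lastEpoch T)).filter
          (fun n => epochOf τ (n + 1) = m)) : ℝ) ≤ (τ m : ℝ) - τ (m - 1) := by
        rw [← Nat.cast_sub (h.mono (Nat.sub_le m 1)), ← Nat.card_Ico]
        exact_mod_cast card_le_card hsub
      rcases hm.1.eq_or_lt with h1 | h1
      · subst h1
        refine (sum_le_card_nsmul _ _ 1 fun n hn => ?_).trans ?_
        · rw [mem_filter, mem_filter, mem_range] at hn
          exact hv1 n hn.1.1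
        · rw [nsmul_eq_mul, mul_one]
          refine hcard.trans ?_
          simp only [Nat.sub_self, h.zero, Nat.cast_zero, sub_zero]
          refine h.first_le.trans ?_
          nlinarith
      · refine (sum_le_card_nsmul _ _ (B / √(τ (m - 1))) fun n hn => ?_).trans ?_
        · rw [mem_filter, mem_filter, mem_range] at hn
          obtain ⟨⟨hn1, -⟩, rfl⟩ := hn
          exact hv n hn1 h1
        · have hτ : (0 : ℝ) < τ (m - 1) := by
            exact_mod_cast h.one_le (m - 1) (by omega)
          have h2 := h.sub_le (m - 1) (by omega) (by omega)
          rw [Nat.sub_add_cancel hm.1] at h2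
          rw [nsmul_eq_mul]
          calc _ ≤ 2 * (√T * √(τ (m - 1))) * (B / √(τ (m - 1))) := by
                gcongr
                exact hcard.trans h2
            _ = 2 * (√T * B) := by
                have := (Real.sqrt_pos.2 hτ).ne'
                field_simp
    refine (sum_le_sum hm).trans_eq ?_
    rw [sum_const, Nat.card_Icc, nsmul_eq_mul, Nat.add_sub_cancel]
    ring
  · rcases Nat.eq_zero_or_pos T with rfl | hT
    · simp
    have hT0 : (0 : ℝ) < T := by exact_mod_cast hT
    have hle : ∀ n ∈ (range T).filter (fun n => ¬ epochOf τ (n + 1) ≤ lastEpoch T),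
        v n ≤ 2 * B / √T := by
      intro n hn
      rw [mem_filter, mem_range, not_le] at hn
      have h1 := h.half_le (epochOf τ (n + 1) - 1) (by omega)
      have hep : epochOf τ (n + 1) - 1 ≠ 0 := fun h0 => by
        rw [h0, h.zero, Nat.cast_zero] at h1
        linarith
      refine (hv n hn.1 (by omega)).trans ?_
      have h2 : √(T : ℝ) / 2 ≤ √(τ (epochOf τ (n + 1) - 1)) := by
        refine Real.le_sqrt_of_sq_le ?_
        rw [div_pow, Real.sq_sqrt hT0.le]
        linarith
      have hsT' := Real.sqrt_pos.2 hT0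
      calc B / √(τ (epochOf τ (n + 1) - 1)) ≤ B / (√T / 2) := by gcongr
        _ = 2 * B / √T := by field_simp
    refine (sum_le_card_nsmul _ _ _ hle).trans ?_
    rw [nsmul_eq_mul]
    calc _ ≤ (T : ℝ) * (2 * B / √T) := by
          gcongr
          exact (card_filter_le _ _).trans_eq (card_range T)
      _ = 2 * (√T * B) := by
          have := (Real.sqrt_pos.2 hT0).ne'
          field_simp
          rw [Real.sq_sqrt hT0.le]

end Schedule

/-! ### Learning rates -/

section LearningRate

theorem one_le_log_of_four_le {c : ℝ} (hc : 4 ≤ c) : 1 ≤ Real.log c := by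
  have h1 := Real.log_le_log (by norm_num) hc
  have h2 : Real.log 4 = 2 * Real.log 2 := by
    rw [← Real.log_rpow (by norm_num)]
    norm_num
  linarith [Real.log_two_gt_d9]

/-- Going from s to t the logarithm grows by log(t/s), and s log(t/s) ≤ t - s ≤ (t - s) log(cs); the
last step uses log(cs) ≥ 1, hence the hypothesis on c. -/
theorem div_log_mono {c s t : ℝ} (hc : 4 ≤ c) (hs : 1 ≤ s) (hst : s ≤ t) :
    s / Real.log (c * s) ≤ t / Real.log (c * t) := by
  have hs1 := one_le_log_of_four_le (by nlinarith : 4 ≤ c * s)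
  have ht1 := one_le_log_of_four_le (by nlinarith : 4 ≤ c * t)
  rw [div_le_div_iff₀ (by linarith) (by linarith)]
  have hs0 : 0 < s := by linarith
  have ht0 : 0 < t := by linarith
  have hc0 : 0 < c := by linarith
  have h1 : Real.log (c * t) = Real.log (c * s) + Real.log (t / s) := by
    rw [← Real.log_mul (by positivity) (by positivity)]
    congr 1
    field_simp
  have h2 := Real.log_le_sub_one_of_pos (by positivity : 0 < t / s)
  have h3 : s * Real.log (t / s) ≤ t - s := by
    calc s * Real.log (t / s) ≤ s * (t / s - 1) := by gcongr
      _ = t - s := by field_simp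
  rw [h1]
  nlinarith

variable {K N : ℕ} {δ : ℝ} {τ : ℕ → ℕ}

theorem learningRate_of_two_le {m : ℕ} (hm : 2 ≤ m) : learningRate K N δ τ m
    = (1 / 30) * √(K * (τ (m - 1) / Real.log (N / δ * τ (m - 1)))) := by
  rw [learningRate, if_neg (by omega), mul_div_assoc, div_mul_eq_mul_div (N : ℝ)]

theorem four_le_div (hN : 4 ≤ N) (hδ : 0 < δ) (hδ1 : δ < 1) : 4 ≤ (N : ℝ) / δ := by
  rw [le_div_iff₀ hδ]
  have : (4 : ℝ) ≤ N := by exact_mod_cast hN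
  linarith

theorem learningRate_pos (hK : 1 ≤ K) (hN : 4 ≤ N) (hδ : 0 < δ) (hδ1 : δ < 1) {m : ℕ}
    (hm : 2 ≤ m) (hτ : 1 ≤ τ (m - 1)) : 0 < learningRate K N δ τ m := by
  have hτ' : (1 : ℝ) ≤ τ (m - 1) := by exact_mod_cast hτ
  have hK' : (1 : ℝ) ≤ K := by exact_mod_cast hK
  have hc := four_le_div hN hδ hδ1
  have := one_le_log_of_four_le (by nlinarith : 4 ≤ (N : ℝ) / δ * τ (m - 1))
  rw [learningRate_of_two_le hm]
  positivity

theorem learningRate_mono (hN : 4 ≤ N) (hδ : 0 < δ) (hδ1 : δ < 1)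
    (hτ : Monotone τ) (hτ1 : 1 ≤ τ 1) {i m : ℕ} (hi : 2 ≤ i) (him : i ≤ m) :
    learningRate K N δ τ i ≤ learningRate K N δ τ m := by
  rw [learningRate_of_two_le hi, learningRate_of_two_le (hi.trans him)]
  have h1 : (1 : ℝ) ≤ τ (i - 1) := by exact_mod_cast hτ1.trans (hτ (by omega))
  have h2 : (τ (i - 1) : ℝ) ≤ τ (m - 1) := by exact_mod_cast hτ (by omega)
  gcongr (1 / 30) * √(K * ?_)
  exact div_log_mono (four_le_div hN hδ hδ1) h1 h2

theorem learningRate_sq (hN : 4 ≤ N) (hδ : 0 < δ) (hδ1 : δ < 1) {m : ℕ}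
    (hm : 2 ≤ m) (hτ : 1 ≤ τ (m - 1)) : learningRate K N δ τ m ^ 2
      = 1 / 900 * (K * τ (m - 1) / Real.log (N / δ * τ (m - 1))) := by
  have hτ' : (1 : ℝ) ≤ τ (m - 1) := by exact_mod_cast hτ
  have hc := four_le_div hN hδ hδ1
  have := one_le_log_of_four_le (by nlinarith : 4 ≤ (N : ℝ) / δ * τ (m - 1))
  rw [learningRate_of_two_le hm, mul_pow, Real.sq_sqrt (by positivity)]
  ring

theorem div_learningRate (hK : 1 ≤ K) (hN : 4 ≤ N) (hδ : 0 < δ) (hδ1 : δ < 1) {m : ℕ}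
    (hm : 2 ≤ m) (hτ : 1 ≤ τ (m - 1)) : K / learningRate K N δ τ m
      = 30 * √(K * Real.log (N / δ * τ (m - 1))) / √(τ (m - 1)) := by
  have hτ' : (1 : ℝ) ≤ τ (m - 1) := by exact_mod_cast hτ
  have hK' : (1 : ℝ) ≤ K := by exact_mod_cast hK
  have hc := four_le_div hN hδ hδ1
  have hL := one_le_log_of_four_le (by nlinarith : 4 ≤ (N : ℝ) / δ * τ (m - 1))
  have h1 : (K : ℝ) = √K * √K := (Real.mul_self_sqrt (by linarith)).symm
  have h2 : 0 < √(K : ℝ) := Real.sqrt_pos.2 (by linarith)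
  have h3 : 0 < √(τ (m - 1) : ℝ) := Real.sqrt_pos.2 (by linarith)
  have h4 : 0 < √(Real.log (N / δ * τ (m - 1))) := Real.sqrt_pos.2 (by linarith)
  rw [learningRate_of_two_le hm, Real.sqrt_mul (by linarith), Real.sqrt_mul (by linarith),
    Real.sqrt_div (by linarith)]
  nth_rewrite 1 [h1]
  field_simp

end LearningRate

/-! ### The algorithm as an adaptive run -/

section Algorithm

variable {X A : Type*}

/-- The learner's observations in the first `k` of `n` rounds. -/
def observedOf {k n : ℕ} (hk : k ≤ n) (h : Fin n → X × (A → I) × A) : Fin k → X × A × I :=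
  fun i => ((h (i.castLE hk)).1, (h (i.castLE hk)).2.2,
    (h (i.castLE hk)).2.1 (h (i.castLE hk)).2.2)

/-- The answer of the oracle on the first `k` of `n` rounds (on no data if `n < k`). -/
def historyPredictor (oracle : (n : ℕ) → (Fin n → X × A × I) → (X → A → I)) (k n : ℕ)
    (h : Fin n → X × (A → I) × A) : X → A → I :=
  if hk : k ≤ n then oracle k (observedOf hk h) else oracle 0 Fin.elim0

/-- The policy of FALCON in round `n + 1`, as a function of the history. -/
def historyPolicy [Fintype A] [DecidableEq A]
    (oracle : (n : ℕ) → (Fin n → X × A × I) → (X → A → I)) (greedy : (X → A → I) → X → A)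
    (γ : ℕ → ℝ) (τ : ℕ → ℕ) (n : ℕ) (h : Fin n → X × (A → I) × A) : X → A → ℝ :=
  inverseGapPolicy (γ (epochOf τ (n + 1)))
    (historyPredictor oracle (τ (epochOf τ (n + 1) - 1)) n h)
    (greedy (historyPredictor oracle (τ (epochOf τ (n + 1) - 1)) n h))

/-- Under `hτ` the oracle's data lie within the available history, so the default branch of
`historyPredictor` is not reached on actual runs. -/
theorem historyPolicy_history {X A Ω : Type*} [Fintype A] [DecidableEq A]
    {oracle : (n : ℕ) → (Fin n → X × A × I) → (X → A → I)} {greedy : (X → A → I) → X → A}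
    {τ : ℕ → ℕ} {x : ℕ → Ω → X} {r : ℕ → Ω → A → I} {a : ℕ → Ω → A} {n : ℕ}
    (hτ : τ (epochOf τ (n + 1) - 1) ≤ n) (γ : ℕ → ℝ) (ω : Ω) :
    historyPolicy oracle greedy γ τ n (history x r a n ω)
      = inverseGapPolicy (γ (epochOf τ (n + 1)))
        (predictor oracle τ x r a (epochOf τ (n + 1)) ω)
        (greedy (predictor oracle τ x r a (epochOf τ (n + 1)) ω)) := by
  rw [historyPolicy, historyPredictor, dif_pos hτ]
  rfl

variable [MeasurableSpace X] [MeasurableSpace A] {F : Finset (X → A → I)}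
  {oracle : (n : ℕ) → (Fin n → X × A × I) → (X → A → I)} {greedy : (X → A → I) → X → A}

/-- The default branch is also an answer of the oracle, so that every history, for any cutoff k,
yields a genuine policy, as `IsAdaptiveRun` demands. -/
theorem historyPredictor_mem (ho : IsLeastSquaresOracle F oracle) (k n : ℕ)
    (h : Fin n → X × (A → I) × A) : historyPredictor oracle k n h ∈ F := by
  unfold historyPredictor
  split_ifs
  · exact ho.mem _ _
  · exact ho.mem _ _

theorem measurable_observedOf [Countable A] [DiscreteMeasurableSpace A] {k n : ℕ} (hk : k ≤ n) :
    Measurable (observedOf hk : (Fin n → X × (A → I) × A) → Fin k → X × A × I) := by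
  refine measurable_pi_lambda _ fun i => ?_
  have h1 : Measurable fun e : X × (A → I) × A => (e.1, e.2.2, e.2.1 e.2.2) :=
    measurable_fst.prodMk ((measurable_snd.comp measurable_snd).prodMk
      (measurable_eval_action (measurable_fst.comp measurable_snd)
        (measurable_snd.comp measurable_snd)))
  exact h1.comp (measurable_pi_apply (i.castLE hk))

theorem measurableSet_historyPredictor_eq [Countable A] [DiscreteMeasurableSpace A]
    (ho : IsLeastSquaresOracle F oracle) (k n : ℕ) {f : X → A → I} (hf : f ∈ F) :
    MeasurableSet {h : Fin n → X × (A → I) × A | historyPredictor oracle k n h = f} := by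
  unfold historyPredictor
  split_ifs with hk
  · exact measurable_observedOf hk (ho.measurableSet k f hf)
  · exact MeasurableSet.const _

/-- The predictor takes values in the finite class `F`, so the policy is a finite sum over `F` of
functions of the context, each cut off to the measurable set of histories where that predictor is
chosen. No measurability of `greedy` in the predictor is required. -/
theorem measurable_historyPolicy [Fintype A] [DecidableEq A] [DiscreteMeasurableSpace A]
    (ho : IsLeastSquaresOracle F oracle) (hF : ∀ f ∈ F, Measurable f)
    (hg : ∀ f ∈ F, IsGreedyPolicy f (greedy f)) (γ : ℕ → ℝ) (τ : ℕ → ℕ) (n : ℕ) (b : A) :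
    Measurable fun y : (Fin n → X × (A → I) × A) × X =>
      historyPolicy oracle greedy γ τ n y.1 y.2 b := by
  classical
  set k := τ (epochOf τ (n + 1) - 1)
  have heq : (fun y : (Fin n → X × (A → I) × A) × X =>
      historyPolicy oracle greedy γ τ n y.1 y.2 b) = fun y => ∑ f ∈ F,
        ({h | historyPredictor oracle k n h = f} ×ˢ Set.univ).indicator
          (fun y => actionProb (γ (epochOf τ (n + 1))) f y.2 (greedy f y.2) b) y := by
    ext y
    rw [Finset.sum_eq_single (historyPredictor oracle k n y.1)]
    · have hy : y ∈ {h | historyPredictor oracle k n h = historyPredictor oracle k n y.1}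
          ×ˢ (Set.univ : Set X) := ⟨rfl, trivial⟩
      rw [Set.indicator_of_mem hy]
      rfl
    · intro f _ hf
      exact Set.indicator_of_notMem (fun h => hf h.1.symm) _
    · exact fun h => (h (historyPredictor_mem ho k n y.1)).elim
  rw [heq]
  refine Finset.measurable_sum _ fun f hf => ?_
  exact ((measurable_actionProb (hF f hf) (hg f hf).measurable _ b).comp
    measurable_snd).indicator ((measurableSet_historyPredictor_eq ho k n hf).prod .univ)

theorem learningRate_nonneg (K N : ℕ) (δ : ℝ) (τ : ℕ → ℕ) (m : ℕ) :
    0 ≤ learningRate K N δ τ m := by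
  unfold learningRate
  split_ifs
  · exact zero_le_one
  · positivity

variable [Fintype A] [DecidableEq A] {Ω : Type*} [MeasurableSpace Ω] {μ : Measure Ω}
  {D : Measure (X × (A → I))} {τ : ℕ → ℕ} {δ : ℝ} {T : ℕ}
  {x : ℕ → Ω → X} {r : ℕ → Ω → A → I} {a : ℕ → Ω → A}

theorem IsRun.isAdaptiveRun [DiscreteMeasurableSpace A]
    (H : IsRun μ D F oracle greedy τ δ T x r a) (hτ : IsGoodSchedule T τ)
    (ho : IsLeastSquaresOracle F oracle) (hF : ∀ f ∈ F, Measurable f)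
    (hg : ∀ f ∈ F, IsGreedyPolicy f (greedy f)) :
    IsAdaptiveRun μ D (historyPolicy oracle greedy (learningRate (Fintype.card A) #F δ τ) τ)
      T x r a where
  measurable_context := H.measurable_context
  measurable_reward := H.measurable_reward
  measurable_action := H.measurable_action
  law := H.law
  indep := H.indep
  policy n h := isStochasticPolicy_inverseGapPolicy (hF _ (historyPredictor_mem ho _ _ _))
    (hg _ (historyPredictor_mem ho _ _ _)) (learningRate_nonneg _ _ _ _ _)
  measurable_policy := measurable_historyPolicy ho hF hg _ τ
  action n hn b := by
    have h := hτ.lt_of_epochOf (Nat.le_add_left 1 n)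
    simp only [historyPolicy_history (Nat.lt_succ_iff.1 h)]
    exact H.action n hn b

end Algorithm

/-! ### The regret bound -/

section Regret

variable {X A : Type*} [MeasurableSpace X] [MeasurableSpace A] [DiscreteMeasurableSpace A]
  [Fintype A] {F : Finset (X → A → I)} {fstar : X → A → I}
  {πstar : X → A} {greedy : (X → A → I) → X → A}
  {δ : ℝ} {T : ℕ} {τ : ℕ → ℕ}

/-- The expected regret of FALCON, if the predictor of each epoch is accurate on the rounds before
that epoch. -/
theorem sum_meanRegret_le [DecidableEq A] [Nonempty A] {ν : Measure X} [IsProbabilityMeasure ν] (hτ : IsGoodSchedule T τ)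
    (hT : 3 ≤ T) (hN : 4 ≤ #F) (hδ : 0 < δ) (hδ1 : δ < 1) (hF : ∀ f ∈ F, Measurable f)
    (hfs : fstar ∈ F) (hπs : IsGreedyPolicy fstar πstar)
    (hg : ∀ f ∈ F, IsGreedyPolicy f (greedy f)) {fhat : ℕ → X → A → I} (hfh : ∀ m, fhat m ∈ F)
    {p : ℕ → X → A → ℝ} (hp : ∀ n < T, p n = inverseGapPolicy
      (learningRate (Fintype.card A) #F δ τ (epochOf τ (n + 1))) (fhat (epochOf τ (n + 1)))
      (greedy (fhat (epochOf τ (n + 1)))))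
    (herr : ∀ m, 2 ≤ m → ∑ n ∈ range (τ (m - 1)), sqErr ν (fhat m) fstar (p n)
      ≤ 32 * Real.log (#F / δ * τ (m - 1))) :
    ∑ n ∈ range T, meanRegret ν fstar πstar (p n) ≤ 9000 *
      (√(Fintype.card A * T * Real.log (#F / δ * T)) * Real.log (Real.log T)) := by
  have hK1 : 1 ≤ Fintype.card A := Fintype.card_pos
  have hK : (1 : ℝ) ≤ Fintype.card A := by exact_mod_cast hK1
  have hT' : (3 : ℝ) ≤ T := by exact_mod_cast hT
  have hc := four_le_div hN hδ hδ1
  have hL := one_le_log_of_four_le (by nlinarith : 4 ≤ (#F : ℝ) / δ * T)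
  set γ := learningRate (Fintype.card A) #F δ τ with hγdef
  have hτ1 : ∀ m, 2 ≤ m → 1 ≤ τ (m - 1) := fun m hm => hτ.one_le _ (by omega)
  have hγpos : ∀ m, 2 ≤ m → 0 < γ m := fun m hm =>
    learningRate_pos hK1 hN hδ hδ1 hm (hτ1 m hm)
  have hcomp := meanRegret_comparison (ν := ν) (fhat := fhat) (πhat := fun m => greedy (fhat m))
    (γ := γ) (τ := τ) (ep := fun n => epochOf τ (n + 1)) (hF _ hfs) hπs
    (fun m => hF _ (hfh m)) (fun m => hg _ (hfh m)) (if_pos rfl) hγpos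
    (fun i m => learningRate_mono hN hδ hδ1 hτ.mono (hτ.one_le 1 le_rfl)) hτ1
    (fun m hm n hn => by
      have h1 := epochOf_le (τ := τ) (by omega : 1 ≤ m - 1)
        (by omega : n + 1 ≤ τ (m - 1))
      exact ⟨(hτ.epochOf_spec ((Nat.succ_le_of_lt hn).trans (hτ.le _))).1, by omega⟩)
    (fun m hm => by
      have hτm : (1 : ℝ) ≤ τ (m - 1) := by exact_mod_cast hτ1 m hm
      have hLm := one_le_log_of_four_le (by nlinarith : 4 ≤ (#F : ℝ) / δ * τ (m - 1))
      -- The factor 1/30 in the learning rate is matched to the oracle's error here: 900 · 8/225 =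
      -- 32.
      rw [learningRate_sq hN hδ hδ1 hm (hτ1 m hm)]
      refine le_of_eq_of_le (sum_congr rfl fun n hn => ?_) ((herr m hm).trans_eq ?_)
      · rw [hp n ((mem_range.1 hn).trans_le (hτ.le _))]
      · have hLm' := (one_pos.trans_le hLm).ne'
        generalize Real.log (#F / δ * τ (m - 1)) = y at hLm'
        field_simp
        norm_num)
  -- Here 90 = 3 · 30: the true regret is at most 2 · K/γ_m + K/γ_m, and K/γ_m carries the factor
  -- 30.
  have hround : ∀ n < T, 2 ≤ epochOf τ (n + 1) → meanRegret ν fstar πstar (p n)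
      ≤ 90 * √(Fintype.card A * Real.log (#F / δ * T)) / √(τ (epochOf τ (n + 1) - 1)) := by
    intro n hn hm
    rw [hp n hn]
    set m := epochOf τ (n + 1) with hmdef
    have hτm : (1 : ℝ) ≤ τ (m - 1) := by exact_mod_cast hτ1 m hm
    have h1 := (hcomp m hm _ (isStochasticPolicy_inverseGapPolicy (hF _ (hfh m)) (hg _ (hfh m))
      (hγpos m hm).le)).1
    have h2 := meanRegret_inverseGapPolicy_le (ν := ν) (hF _ (hfh m)) (hg _ (hfh m)) (hγpos m hm)
    have h3 := div_learningRate hK1 hN hδ hδ1 hm (hτ1 m hm)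
    have h4 : 30 * √(Fintype.card A * Real.log (#F / δ * τ (m - 1))) / √(τ (m - 1))
        ≤ 30 * √(Fintype.card A * Real.log (#F / δ * T)) / √(τ (m - 1)) := by
      have : (τ (m - 1) : ℝ) ≤ T := by exact_mod_cast hτ.le _
      gcongr
    rw [mul_div_assoc, mul_div_assoc] at h4
    rw [mul_div_assoc] at h3 ⊢
    rw [← hγdef] at h3
    linarith
  have hpol : ∀ n < T, IsStochasticPolicy (p n) := fun n hn => by
    rw [hp n hn]
    exact isStochasticPolicy_inverseGapPolicy (hF _ (hfh _)) (hg _ (hfh _))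
      (learningRate_nonneg _ _ _ _ _)
  have hKL : 1 ≤ √(Fintype.card A * Real.log (#F / δ * T)) :=
    Real.one_le_sqrt.2 (by nlinarith)
  have hsum := hτ.sum_le (by linarith : 1 ≤ 90 * √(Fintype.card A * Real.log (#F / δ * T)))
    (fun n hn => meanRegret_le_one (hF _ hfs) hπs.measurable (hpol n hn)) hround
  have hM1 : (1 : ℝ) ≤ lastEpoch T := by exact_mod_cast one_le_lastEpoch hT
  have hM := lastEpoch_le hT
  have hS : √(T : ℝ) * (90 * √(Fintype.card A * Real.log (#F / δ * T)))
      = 90 * √(Fintype.card A * T * Real.log (#F / δ * T)) := by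
    rw [mul_left_comm, ← Real.sqrt_mul (by linarith)]
    congr 2
    ring
  rw [hS] at hsum
  have hS0 := Real.sqrt_nonneg (Fintype.card A * T * Real.log (#F / δ * T))
  -- Since `lastEpoch T ≥ 1`, 2M + 2 ≤ 4M ≤ 100 log log T; multiplied by 90 this is the 9000.
  nlinarith [mul_le_mul_of_nonneg_right (by linarith : 2 * (lastEpoch T : ℝ) + 2
    ≤ 100 * Real.log (Real.log T)) hS0]

theorem sum_one_div_mul_succ_le (T : ℕ) :
    ∑ n ∈ Icc 1 T, 1 / ((n : ℝ) * (n + 1)) ≤ 1 := by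
  have h : ∑ n ∈ Icc 1 T, 1 / ((n : ℝ) * (n + 1)) = 1 - 1 / ((T : ℝ) + 1) := by
    induction T with
    | zero => simp
    | succ n ih =>
      rw [sum_Icc_succ_top (by omega), ih]
      push_cast
      field_simp
      ring
  rw [h]
  linarith [(by positivity : 0 ≤ 1 / ((T : ℝ) + 1))]

/-- The weights δ/(2N n(n+1)) sum to at most δ/2 over predictors and n. Their price is only a factor
2 in the logarithm, because n + 1 ≤ 2n and N/δ ≥ 4. -/
theorem log_confidence_le {N n : ℕ} (hN : 4 ≤ N) (hn : 1 ≤ n) (hδ : 0 < δ) (hδ1 : δ < 1) :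
    Real.log (1 / (δ / (2 * N) * (1 / ((n : ℝ) * (n + 1))))) ≤ 2 * Real.log (N / δ * n) := by
  have hc := four_le_div hN hδ hδ1
  have hn' : (1 : ℝ) ≤ n := by exact_mod_cast hn
  have hN' : (4 : ℝ) ≤ N := by exact_mod_cast hN
  have h2 : 2 * Real.log (N / δ * n) = Real.log ((N / δ * n) ^ 2) := by
    rw [Real.log_pow]
    norm_num
  rw [h2]
  have h1 : 1 / (δ / (2 * N) * (1 / ((n : ℝ) * (n + 1)))) = 2 * (N / δ) * (n * (n + 1)) := by
    field_simp
  refine Real.log_le_log (by positivity) ?_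
  rw [h1]
  have h3 : 2 * ((n : ℝ) * (n + 1)) ≤ 4 * n ^ 2 := by nlinarith
  calc 2 * (N / δ) * ((n : ℝ) * (n + 1)) = N / δ * (2 * (n * (n + 1))) := by ring
    _ ≤ N / δ * (4 * n ^ 2) := by gcongr
    _ ≤ N / δ * (N / δ * n ^ 2) := by gcongr
    _ = (N / δ * n) ^ 2 := by ring

variable {Ω : Type*} [MeasurableSpace Ω] {μ : Measure Ω} [IsProbabilityMeasure μ]
  {D : Measure (X × (A → I))} [IsProbabilityMeasure D]
  {oracle : (n : ℕ) → (Fin n → X × A × I) → (X → A → I)}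
  {x : ℕ → Ω → X} {r : ℕ → Ω → A → I} {a : ℕ → Ω → A}

theorem regret_le {X A Ω : Type*} (π : X → A) (x : ℕ → Ω → X) (r : ℕ → Ω → A → I)
    (a : ℕ → Ω → A) (T : ℕ) (ω : Ω) : regret π x r a T ω ≤ T := by
  rw [regret_eq_sum_range]
  refine (sum_le_card_nsmul _ _ 1 fun i _ => (le_abs_self _).trans (abs_sub_le_one _ _)).trans ?_
  simp

theorem prob_ge_of_compl_subset {B G : Set Ω} (hBG : Bᶜ ⊆ G) {ε : ℝ} (hε : 0 ≤ ε)
    (hB : μ B ≤ ENNReal.ofReal ε) : ENNReal.ofReal (1 - ε) ≤ μ G := by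
  rw [ENNReal.ofReal_sub _ hε, ENNReal.ofReal_one, tsub_le_iff_right]
  calc (1 : ENNReal) = μ (B ∪ Bᶜ) := by rw [Set.union_compl_self, measure_univ]
    _ ≤ μ B + μ Bᶜ := measure_union_le _ _
    _ ≤ ENNReal.ofReal ε + μ G := add_le_add hB (measure_mono hBG)
    _ = _ := add_comm _ _

/-- With probability at least `1 - δ / 2`, the predictors that fit the data of the first `n` rounds
as well as `fstar` does are accurate on these rounds, for all `n ≤ T`. -/
theorem IsAdaptiveRun.measure_exists_sqErr_gt_le
    {P : (n : ℕ) → (Fin n → X × (A → I) × A) → X → A → ℝ}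
    (H : IsAdaptiveRun μ D P T x r a) (hreal : Realizes D fstar) (hN : 4 ≤ #F)
    (hδ : 0 < δ) (hδ1 : δ < 1) (hF : ∀ f ∈ F, Measurable f) (hfs : fstar ∈ F) :
    μ {ω | ∃ n ∈ Icc 1 T, ∃ f ∈ F,
      squaredLoss f (observed x r a n ω) ≤ squaredLoss fstar (observed x r a n ω) ∧
      32 * Real.log (#F / δ * n)
        < ∑ i ∈ range n, sqErr (D.map Prod.fst) f fstar (P i (history x r a i ω))}
      ≤ ENNReal.ofReal (δ / 2) := by
  have hN' : (4 : ℝ) ≤ #F := by exact_mod_cast hN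
  let ε : ℕ → ℝ := fun n => δ / (2 * #F) * (1 / ((n : ℝ) * (n + 1)))
  have hε : ∀ n, 1 ≤ n → 0 < ε n := fun n hn => by
    have hn' : (1 : ℝ) ≤ n := by exact_mod_cast hn
    positivity
  calc μ _ ≤ μ (⋃ n ∈ Icc 1 T, ⋃ f ∈ F,
        {ω | 2 * (squaredLoss f (observed x r a n ω) - squaredLoss fstar (observed x r a n ω))
          + 16 * Real.log (1 / ε n)
          < ∑ i ∈ range n, sqErr (D.map Prod.fst) f fstar (P i (history x r a i ω))}) := by
        refine measure_mono fun ω hω => ?_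
        obtain ⟨n, hn, f, hf, h1, h2⟩ := hω
        refine Set.mem_biUnion hn (Set.mem_biUnion hf ?_)
        have h3 := log_confidence_le hN (mem_Icc.1 hn).1 hδ hδ1
        refine lt_of_le_of_lt ?_ h2
        linarith
    _ ≤ ∑ n ∈ Icc 1 T, ∑ f ∈ F, ENNReal.ofReal (ε n) := by
        refine (measure_biUnion_finset_le _ _).trans (sum_le_sum fun n hn => ?_)
        refine (measure_biUnion_finset_le _ _).trans (sum_le_sum fun f hf => ?_)
        exact H.measure_sqErr_gt_le hreal (hF _ hfs) (hF f hf) (mem_Icc.1 hn).2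
          (hε n (mem_Icc.1 hn).1)
    _ = ENNReal.ofReal (∑ n ∈ Icc 1 T, ∑ _f ∈ F, ε n) := by
        rw [ENNReal.ofReal_sum_of_nonneg fun n hn =>
          sum_nonneg fun _ _ => (hε n (mem_Icc.1 hn).1).le]
        refine sum_congr rfl fun n hn => ?_
        rw [ENNReal.ofReal_sum_of_nonneg fun _ _ => (hε n (mem_Icc.1 hn).1).le]
    _ ≤ ENNReal.ofReal (δ / 2) := by
        refine ENNReal.ofReal_le_ofReal ?_
        calc ∑ n ∈ Icc 1 T, ∑ _f ∈ F, ε n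
            = δ / 2 * ∑ n ∈ Icc 1 T, 1 / ((n : ℝ) * (n + 1)) := by
              rw [mul_sum]
              refine sum_congr rfl fun n _ => ?_
              rw [sum_const, nsmul_eq_mul]
              simp only [ε]
              field_simp
          _ ≤ δ / 2 * 1 := by
              gcongr
              exact sum_one_div_mul_succ_le T
          _ = δ / 2 := mul_one _

/-- The regret bound of FALCON. -/
theorem IsRun.prob_regret_le [DecidableEq A] [Nonempty A]
    (H : IsRun μ D F oracle greedy τ δ T x r a)
    (hτ : IsGoodSchedule T τ) (hT : 3 ≤ T) (hN : 4 ≤ #F) (hδ : 0 < δ) (hδ1 : δ < 1)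
    (hF : ∀ f ∈ F, Measurable f) (hfs : fstar ∈ F) (hreal : Realizes D fstar)
    (hπs : IsGreedyPolicy fstar πstar) (ho : IsLeastSquaresOracle F oracle)
    (hg : ∀ f ∈ F, IsGreedyPolicy f (greedy f)) :
    ENNReal.ofReal (1 - δ) ≤ μ {ω | regret πstar x r a T ω ≤ 10000 *
      (√(Fintype.card A * T * Real.log (#F * T / δ)) * Real.log (Real.log T))} := by
  have hν : IsProbabilityMeasure (D.map Prod.fst) :=
    Measure.isProbabilityMeasure_map measurable_fst.aemeasurable
  have hK : (1 : ℝ) ≤ Fintype.card A := by exact_mod_cast (Fintype.card_pos : 0 < Fintype.card A)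
  have hT' : (3 : ℝ) ≤ T := by exact_mod_cast hT
  have hN' : (4 : ℝ) ≤ #F := by exact_mod_cast hN
  have hc := four_le_div hN hδ hδ1
  have hL := one_le_log_of_four_le (by nlinarith : 4 ≤ (#F : ℝ) / δ * T)
  have hy := log_log_lower_bound hT
  have hrun := H.isAdaptiveRun hτ ho hF hg
  rw [← div_mul_eq_mul_div]
  have hTL : √((T : ℝ) * Real.log (#F / δ * T))
      ≤ √(Fintype.card A * T * Real.log (#F / δ * T)) := by
    rw [mul_assoc]
    exact Real.sqrt_le_sqrt (le_mul_of_one_le_left (by positivity) hK)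
  have hlogε : Real.log (1 / (δ / 2)) ≤ Real.log (#F / δ * T) := by
    refine Real.log_le_log (by positivity) ?_
    rw [one_div_div, div_mul_eq_mul_div]
    gcongr
    nlinarith
  set L := Real.log (#F / δ * T) with hLdef
  set S := √(Fintype.card A * T * L) with hSdef
  have hS0 : 0 ≤ S := Real.sqrt_nonneg _
  -- The constant 25/2 is the inverse of the lower bound 2/25 for log log T.
  have hSy : S ≤ 25 / 2 * (S * Real.log (Real.log T)) := by nlinarith
  -- If L > T, the trivial bound T ≤ √(TL) suffices; otherwise L/T ≤ 1 makes the tilt l below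
  -- admissible.
  rcases lt_or_ge (T : ℝ) L with hlt | hge
  · refine le_of_le_of_eq (ENNReal.ofReal_le_one.2 (by linarith)) ?_
    rw [← measure_univ (μ := μ)]
    congr 1
    refine (Set.eq_univ_of_forall fun ω => ?_).symm
    have h1 := regret_le πstar x r a T ω
    have h2 : (T : ℝ) ≤ √(T * L) := Real.le_sqrt_of_sq_le (by nlinarith)
    show regret πstar x r a T ω ≤ _
    linarith
  -- This l balances 4lT against L/l: both equal 2√(TL), so the deviation is at most 4√(TL) ≤ 4S ≤
  -- 50 · S log log T, well within 10000 - 9000.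
  · set l := √(L / T) / 2 with hl
    have hl0 : 0 < l := by positivity
    have hl1 : l ≤ 1 / 2 := by
      have : √(L / T) ≤ 1 := Real.sqrt_le_one.2 ((div_le_one (by linarith)).2 hge)
      linarith
    have hlT : l * T = √(T * L) / 2 := by
      have h1 : √(L / T) * T = √(T * L) := by
        rw [eq_comm, Real.sqrt_eq_iff_mul_self_eq (by positivity) (by positivity), eq_comm]
        have := Real.mul_self_sqrt (by positivity : 0 ≤ L / T)
        calc √(L / T) * T * (√(L / T) * T) = √(L / T) * √(L / T) * T * T := by ring
          _ = T * L := by rw [this]; field_simp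
      rw [hl, ← h1]
      ring
    have hLl : L / l = 2 * √(T * L) := by
      rw [div_eq_iff hl0.ne']
      have h1 := Real.mul_self_sqrt (by positivity : 0 ≤ T * L)
      have h2 : √(T * L) * (l * T) = T * L / 2 := by
        rw [hlT]
        linarith
      have hT0 : (T : ℝ) ≠ 0 := by positivity
      refine mul_right_cancel₀ hT0 ?_
      linarith
    have hbad := (measure_union_le _ _).trans (add_le_add
      (hrun.measure_exists_sqErr_gt_le hreal hN hδ hδ1 hF hfs)
      (hrun.measure_regret_gt_le hreal (hF _ hfs) hπs.measurable (half_pos hδ) hl0 hl1))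
    rw [← ENNReal.ofReal_add (by linarith) (by linarith), add_halves] at hbad
    refine prob_ge_of_compl_subset (fun ω hω => ?_) hδ.le hbad
    rw [Set.compl_union] at hω
    obtain ⟨h1, h2⟩ := hω
    have h2' : regret πstar x r a T ω ≤ ∑ i ∈ range T, meanRegret (D.map Prod.fst) fstar πstar
        (historyPolicy oracle greedy (learningRate (Fintype.card A) #F δ τ) τ i
          (history x r a i ω)) + 4 * l * T + Real.log (1 / (δ / 2)) / l := not_lt.1 h2
    have h3 := sum_meanRegret_le (ν := D.map Prod.fst) hτ hT hN hδ hδ1 hF hfs hπs hg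
      (fhat := fun m => predictor oracle τ x r a m ω) (fun m => ho.mem _ _)
      (p := fun n => historyPolicy oracle greedy (learningRate (Fintype.card A) #F δ τ) τ n
        (history x r a n ω))
      (fun n _ => historyPolicy_history
        (Nat.lt_succ_iff.1 (hτ.lt_of_epochOf (Nat.le_add_left 1 n))) _ ω)
      -- The oracle's answer is random, so the uniform event is needed: it covers n = τ_{m-1} and
      -- every predictor that fits at least as well as `fstar`.
      (fun m hm => not_lt.1 fun hlt => h1 ⟨τ (m - 1), mem_Icc.2
        ⟨hτ.one_le _ (by omega), hτ.le _⟩, _, ho.mem _ _, ho.le _ _ _ hfs, hlt⟩)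
    have h4 : Real.log (1 / (δ / 2)) / l ≤ L / l := by gcongr
    show regret πstar x r a T ω ≤ _
    have h5 : 4 * l * T = 2 * √(T * L) := by
      rw [mul_assoc, hlT]
      ring
    have h6 : 0 ≤ S * Real.log (Real.log T) := by positivity
    linarith

end Regret

end Falcon

end

/-! ### The theorem -/

theorem corollary1 :
    ∃ C : ℝ, 0 < C ∧
      -- the number of epochs, each with one oracle call, over `T` rounds
      (∀ T : ℕ, 3 ≤ T →
        T ≤ Falcon.closedSchedule T (Falcon.epochOf (Falcon.closedSchedule T) T) ∧
        (Falcon.epochOf (Falcon.closedSchedule T) T : ℝ) ≤ C * Real.log (Real.log T)) ∧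
      -- the regret
      ∀ {X A Ω : Type*} [MeasurableSpace X] [Fintype A] [DecidableEq A] [Nonempty A]
        [MeasurableSpace A] [DiscreteMeasurableSpace A] [MeasurableSpace Ω]
        (μ : Measure Ω) [IsProbabilityMeasure μ]
        (D : Measure (X × (A → I))) [IsProbabilityMeasure D]
        (F : Finset (X → A → I)) (fstar : X → A → I) (πstar : X → A)
        (oracle : (n : ℕ) → (Fin n → X × A × I) → (X → A → I))
        (greedy : (X → A → I) → X → A)
        (T : ℕ) (τ : ℕ → ℕ) (δ : ℝ)
        (x : ℕ → Ω → X) (r : ℕ → Ω → A → I) (a : ℕ → Ω → A),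
        4 ≤ #F → (∀ f ∈ F, Measurable f) →
        fstar ∈ F → Falcon.Realizes D fstar → Falcon.IsGreedyPolicy fstar πstar →
        Falcon.IsLeastSquaresOracle F oracle →
        (∀ f ∈ F, Falcon.IsGreedyPolicy f (greedy f)) →
        3 ≤ T → 0 < δ → δ < 1 →
        (τ = Falcon.schedule T ∨ τ = Falcon.closedSchedule T) →
        Falcon.IsRun μ D F oracle greedy τ δ T x r a →
        ENNReal.ofReal (1 - δ) ≤
          μ {ω | Falcon.regret πstar x r a T ω ≤
            C * (√((Fintype.card A : ℝ) * (T : ℝ) * Real.log ((#F : ℝ) * (T : ℝ) / δ)) *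
              Real.log (Real.log T))} := by
  refine ⟨10000, by norm_num, fun T hT => ?_, ?_⟩
  · have h := Falcon.isGoodSchedule_closedSchedule hT
    refine ⟨(h.epochOf_spec le_rfl).2, ?_⟩
    have h1 : Falcon.epochOf (Falcon.closedSchedule T) T ≤ Falcon.lastEpoch T :=
      Falcon.epochOf_le (Falcon.one_le_lastEpoch hT) (Falcon.closedSchedule_of_ge le_rfl).ge
    have h2 : (Falcon.epochOf (Falcon.closedSchedule T) T : ℝ) ≤ Falcon.lastEpoch T := by
      exact_mod_cast h1
    linarith [Falcon.lastEpoch_le hT, Falcon.log_log_lower_bound hT]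
  · intro X A Ω _ _ _ _ _ _ _ μ _ D _ F fstar πstar oracle greedy T τ δ x r a hN hF hfs hreal hπs
      ho hg hT hδ hδ1 hτ H
    have hgood : Falcon.IsGoodSchedule T τ := by
      rcases hτ with rfl | rfl
      · exact Falcon.isGoodSchedule_schedule hT
      · exact Falcon.isGoodSchedule_closedSchedule hT
    exact H.prob_regret_le hgood hT hN hδ hδ1 hF hfs hreal hπs ho hg
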